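/- **Setting.** Let $M_4=\mathbb R^4$ carry the Minkowski form $x\cdot y=x^0y^0-x^1y^1-x^2y^2-x^3y^3$, $x^2=x\cdot x$, let $V_+=\{x: x^2>0,\ x^0>0\}$, and let $\overline{V_+}$ be its closure. For $O\subset M_4$ put $O'=\{x:(x-y)^2<0\ \text{for all}\ y\in O\}$; $O_1,O_2$ are *causally separated* if $O_1\subset O_2'$. A *double cone* is a set $(p+V_+)\cap(q-V_+)$ with $q-p\in V_+$. Let $\mathcal K$ be a set of nonempty bounded subsets of $M_4$ which contains all double cones and is stable under the restricted Poincaré group $\mathcal P_+^\uparrow$. Let $\{\mathcal A(O)\}_{O\in\mathcal K}$ be a local net of observables: $\mathcal A$ is a unital $C^*$-algebra and the $\mathcal A(O)\subset\mathcal A$ are $C^*$-subalgebras containing $1$ which are $W^*$-algebras; $\mathcal A(O_1)\subset\mathcal A(O_2)$ if $O_1\subset O_2$; $\mathcal A(O_1)$ and $\mathcal A(O_2)$ commute if $O_1,O_2$ are causally separated; $\bigcup_O\mathcal A(O)$ is norm dense in $\mathcal A$; and there is an action $\alpha$ of $\mathcal P_+^\uparrow$ on $\mathcal A$ by $*$-automorphisms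 with $\alpha_g(\mathcal A(O))=\mathcal A(gO)$, strongly continuous in the sense that $\varphi(|\alpha_g(X)-\alpha_{g_0}(X)|^2)\to0$ as $g\to g_0$ for all $X\in\mathcal A$ and all locally normal positive functionals $\varphi$ (those whose restriction to each $\mathcal A(O)$ is normal). For $O\subset M_4$ let $\mathcal A(O')$ be the $C^*$-algebra generated by the $\mathcal A(O_1)$ with $O_1\in\mathcal K$, $O_1\subset O'$. Let $\mathcal K_\Subset$ be the set of pairs $\Lambda=(O_1^\Lambda,O_2^\Lambda)$ in $\mathcal K\times\mathcal K$ with $\overline{O_1^\Lambda}\subsetneq O_2^\Lambda$, and $\mathcal K_\Subset^{DC}$ the set of those consisting of double cones. The net is assumed to have *property B*: for every $\Lambda\in\mathcal K_\Subset$ and every nonzero projection $E\in\mathcal A(O_1^\Lambda)$ there is $W\in\mathcal A(O_2^\Lambda)$ with $W^*W=1$, $WW^*=E$. Let $\omega_0$ be a vacuum state: a locally normal $\mathcal P_+^\uparrow$-invariant state on $\mathcal A$ whose GNS representation $(\pi_0,\mathcal H_0,\Omega)$ is irreducible on a separable Hilbert space, such that $\Omega$ is cyclic and separating for $\pi_0(\mathcal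 A(O))$ for all $O\in\mathcal K$, and such that $\alpha$ is implemented on $\mathcal H_0$ by a strongly continuous unitary representation of the universal covering group $\mathbb R^4\rtimes SL(2,\mathbb C)$ of $\mathcal P_+^\uparrow$ which fixes $\Omega$ and whose translation subgroup has its joint spectrum in $\overline{V_+}$. Assume Haag duality: $\pi_0(\mathcal A(O'))'=\pi_0(\mathcal A(O))''$ for every double cone $O$. For a representation $\pi$ of $\mathcal A$ put $\pi^d(O)=\pi(\mathcal A(O'))'$. **Definitions.** A *local state* with inclusion pair $\Lambda\in\mathcal K_\Subset$ is a unital completely positive map $T:\mathcal A\to\mathcal A$ such that $T(AB)=T(A)B$ for all $A\in\mathcal A$, $B\in\mathcal A((O_2^\Lambda)')$, and such that for some normal state $\varphi$ on $\mathcal A(O_1^\Lambda)$, $T(A)=\varphi(A)1$ for all $A\in\mathcal A(O_1^\Lambda)$. Let $(\pi_{T,0},\mathcal K_{T,0},V_{T,0})$ be the minimal Stinespring representation of $\pi_0\circ T$. A representation $\pi$ of $\mathcal A$ has *property DHR* if for every $\Lambda\in\mathcal K_\Subset^{DC}$ and every nonzero projection $E\in\pi^d(O_1^\Lambda)$ there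 is $W\in\pi^d(O_2^\Lambda)$ with $W^*W=1$ and $WW^*=E$; $T$ has property DHR if $\pi_{T,0}$ does. A *localized endomorphism with support in $O$* is a $*$-endomorphism $\rho$ of $\pi_0(\mathcal A)$ which is the identity on $\pi_0(\mathcal A(O'))$. It is *transportable* if for every $a\in\mathbb R^4$ there are a localized endomorphism $\rho'$ with support in $O+a$ and a unitary $U\in\pi_0(\mathcal A)''$ with $\rho=\mathrm{Ad}\,U\circ\rho'$. Let $T$ be a local state with inclusion pair $\Lambda\in\mathcal K_\Subset^{DC}$. A localized endomorphism $\rho$ with support in a double cone $O\supseteq O_2^\Lambda$ *corresponds to* $T$ if there is $V\in\pi_0^d(O)$ such that $(\rho\circ\pi_0,\mathcal H_0,V)$ is a minimal Stinespring representation of $\pi_0\circ T$; in particular $(\pi_0\circ T)(X)=V^*\rho(\pi_0(X))V$ for $X\in\mathcal A$. **Corollary.** Let $\Lambda_1,\Lambda_2\in\mathcal K_\Subset^{DC}$ be such that $O_2^{\Lambda_1}$ and $O_2^{\Lambda_2}$ are causally separated, and let $T_j$ be a local state with inclusion pair $\Lambda_j$ which has property DHR ($j=1,2$). If the localized endomorphisms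 corresponding to $T_1$ and to $T_2$ (with supports in double cones containing $O_2^{\Lambda_1}$, respectively $O_2^{\Lambda_2}$) are transportable, then $$\pi_0\circ(T_1\circ T_2)=\pi_0\circ(T_2\circ T_1).$$ -/

import Mathlib

open Set Filter Topology MeasureTheory
open scoped ComplexConjugate InnerProductSpace CStarAlgebra ComplexOrder Matrix

universe u v w z

noncomputable section

/-! ### Four-dimensional Minkowski space and the Poincare group -/

/-- Four-dimensional space-time; coordinate `0` is time. -/
abbrev M4 : Type := Fin 4 → ℝ

/-- The Minkowski form, of signature `(+,-,-,-)`. -/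
def mink (x y : M4) : ℝ := x 0 * y 0 - x 1 * y 1 - x 2 * y 2 - x 3 * y 3

/-- The open forward light cone `V₊`. -/
def forwardCone : Set M4 := {x | 0 < mink x x ∧ 0 < x 0}

/-- The closed forward light cone. -/
def closedForwardCone : Set M4 := {x | 0 ≤ mink x x ∧ 0 ≤ x 0}

/-- The causal complement: the points that are spacelike to every point of the region. -/
def causalComplement (O : Set M4) : Set M4 := {x | ∀ y ∈ O, mink (x - y) (x - y) < 0}

/-- Causal separation of two regions. -/
def CausallySeparated (O₁ O₂ : Set M4) : Prop := O₁ ⊆ causalComplement O₂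

/-- (Open, nonempty) double cones `(p + V₊) ∩ (q - V₊)` with `q - p ∈ V₊`. -/
def IsDoubleCone (O : Set M4) : Prop :=
  ∃ p q : M4, q - p ∈ forwardCone ∧ O = {x | x - p ∈ forwardCone ∧ q - x ∈ forwardCone}

/-- The translate `O + a`. -/
def translateRegion (a : M4) (O : Set M4) : Set M4 := (fun x => x + a) '' O

/-- The restricted (proper orthochronous) Lorentz group: linear isomorphisms that preserve the
Minkowski form, have positive determinant and map the forward cone into itself. -/
def restrictedLorentz : Subgroup (M4 ≃ₗ[ℝ] M4) where
  carrier := {L | (∀ x y, mink (L x) (L y) = mink x y) ∧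
    0 < LinearMap.det (L : M4 →ₗ[ℝ] M4) ∧ ∀ x ∈ forwardCone, L x ∈ forwardCone}
  one_mem' := by
    refine ⟨fun x y => rfl, ?_, fun x hx => hx⟩
    have h : ((1 : M4 ≃ₗ[ℝ] M4) : M4 →ₗ[ℝ] M4) = LinearMap.id := rfl
    rw [h, LinearMap.det_id]
    exact one_pos
  mul_mem' := by
    rintro L M ⟨h1, h2, h3⟩ ⟨k1, k2, k3⟩
    refine ⟨fun x y => (h1 _ _).trans (k1 x y), ?_, fun x hx => h3 _ (k3 x hx)⟩
    have h : ((L * M : M4 ≃ₗ[ℝ] M4) : M4 →ₗ[ℝ] M4)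
        = (L : M4 →ₗ[ℝ] M4) ∘ₗ (M : M4 →ₗ[ℝ] M4) := rfl
    rw [h, LinearMap.det_comp]
    exact mul_pos h2 k2
  inv_mem' := by
    rintro L ⟨h1, h2, h3⟩
    have hL : ∀ x, L (L⁻¹ x) = x := fun x => L.apply_symm_apply x
    have key : ∀ x y, mink (L⁻¹ x) (L⁻¹ y) = mink x y := fun x y => by
      rw [← h1, hL, hL]
    refine ⟨key, ?_, fun x hx => ?_⟩
    · have h : ((L⁻¹ : M4 ≃ₗ[ℝ] M4) : M4 →ₗ[ℝ] M4) ∘ₗ (L : M4 →ₗ[ℝ] M4) = LinearMap.id := by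
        refine LinearMap.ext fun x => ?_
        exact L.symm_apply_apply x
      have h' := congrArg LinearMap.det h
      rw [LinearMap.det_comp, LinearMap.det_id] at h'
      exact pos_of_mul_pos_left (by rw [h']; exact one_pos) h2.le
    · refine ⟨by rw [key]; exact hx.1, ?_⟩
      by_contra hneg
      have hq : 0 < mink (L⁻¹ x) (L⁻¹ x) := by rw [key]; exact hx.1
      have hne : (L⁻¹ x) 0 ≠ 0 := by
        intro h0
        unfold mink at hq
        rw [h0] at hq
        nlinarith [mul_self_nonneg ((L⁻¹ x) 1), mul_self_nonneg ((L⁻¹ x) 2),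
          mul_self_nonneg ((L⁻¹ x) 3)]
      have hm : -(L⁻¹ x) ∈ forwardCone := by
        refine ⟨?_, ?_⟩
        · have : mink (-(L⁻¹ x)) (-(L⁻¹ x)) = mink (L⁻¹ x) (L⁻¹ x) := by
            simp only [mink, Pi.neg_apply]; ring
          rw [this]; exact hq
        · have : (L⁻¹ x) 0 < 0 := lt_of_le_of_ne (not_lt.mp hneg) hne
          simpa using this
      have h4 := (h3 _ hm).2
      rw [map_neg, hL] at h4
      have h5 := hx.2
      simp only [Pi.neg_apply] at h4
      linarith

/-- The restricted Poincare group: the affine transformations `x ↦ L x + a` of space-time with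
`L` in the restricted Lorentz group. -/
def Poincare : Subgroup (M4 ≃ᵃ[ℝ] M4) := restrictedLorentz.comap AffineEquiv.linearHom

/-- The Poincare group carries the topology of pointwise convergence on space-time. -/
instance : TopologicalSpace Poincare :=
  TopologicalSpace.induced (fun g => ((g : M4 ≃ᵃ[ℝ] M4) : M4 → M4)) inferInstance

/-- The image of a region under a Poincare transformation. -/
def poincareImage (g : Poincare) (O : Set M4) : Set M4 := (g : M4 ≃ᵃ[ℝ] M4) '' O

/-- The Hermitian matrix `x⁰ + x¹σ₁ + x²σ₂ + x³σ₃` of a space-time vector. -/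
def hermitianOf (x : M4) : Matrix (Fin 2) (Fin 2) ℂ :=
  !![(x 0 + x 3 : ℂ), x 1 - Complex.I * x 2; x 1 + Complex.I * x 2, x 0 - x 3]

/-- The action of `SL(2, ℂ)` on space-time through the covering map onto the restricted Lorentz
group: the vector whose Hermitian matrix is `S X Sᴴ`, with `X` the Hermitian matrix of `x`. -/
def spinAct (S : Matrix.SpecialLinearGroup (Fin 2) ℂ) (x : M4) : M4 :=
  let Y := (S : Matrix (Fin 2) (Fin 2) ℂ) * hermitianOf x * (S : Matrix (Fin 2) (Fin 2) ℂ)ᴴ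
  ![(Y 0 0 + Y 1 1).re / 2, (Y 1 0).re, (Y 1 0).im, (Y 0 0 - Y 1 1).re / 2]

/-- The element `(a, S)` of the universal covering group `ℝ⁴ ⋊ SL(2, ℂ)` lies over `g`. -/
def LiesOver (a : M4) (S : Matrix.SpecialLinearGroup (Fin 2) ℂ) (g : Poincare) : Prop :=
  ∀ x, (g : M4 ≃ᵃ[ℝ] M4) x = spinAct S x + a

/-! ### Normal functionals, commutants, Stinespring representations -/

/-- A faithful unital representation realises a star algebra as a von Neumann algebra if its range
equals its own double commutant (`Set.centralizer` is the commutant). -/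
def IsVonNeumannRealization {M : Type u} [Ring M] [StarRing M] [Algebra ℂ M]
    {L : Type v} [NormedAddCommGroup L] [InnerProductSpace ℂ L] [CompleteSpace L]
    (σ : M →⋆ₐ[ℂ] (L →L[ℂ] L)) : Prop :=
  Function.Injective σ ∧ centralizer (centralizer (range σ)) = range σ

/-- Normal linear functionals on a `W⋆`-algebra: in a realisation as a von Neumann algebra they are
of the form `A ↦ Tr (s A)` with `s` of trace class, that is `A ↦ ∑ₙ ⟪xₙ, A yₙ⟫` with
square-summable sequences of vectors. -/
def IsNormalFunctional {M : Type u} [Ring M] [StarRing M] [Algebra ℂ M] (φ : M →ₗ[ℂ] ℂ) : Prop :=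
  ∃ (L : Type u) (_ : NormedAddCommGroup L) (_ : InnerProductSpace ℂ L) (_ : CompleteSpace L)
    (σ : M →⋆ₐ[ℂ] (L →L[ℂ] L)), IsVonNeumannRealization σ ∧
    ∃ x y : ℕ → L, Summable (fun n => ‖x n‖ ^ 2) ∧ Summable (fun n => ‖y n‖ ^ 2) ∧
      ∀ A : M, HasSum (fun n => ⟪x n, σ A (y n)⟫_ℂ) (φ A)

/-- Positive linear functionals. -/
def IsPositiveFunctional {M : Type u} [Ring M] [StarRing M] [Algebra ℂ M]
    (φ : M →ₗ[ℂ] ℂ) : Prop := ∀ A : M, 0 ≤ φ (star A * A)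

/-- States. -/
def IsState {M : Type u} [Ring M] [StarRing M] [Algebra ℂ M] (φ : M →ₗ[ℂ] ℂ) : Prop :=
  IsPositiveFunctional φ ∧ φ 1 = 1

/-- `(π, K, V)` is a minimal Stinespring representation of `Φ : A → B(H)`. -/
def IsMinimalStinespring {A : Type u} [CStarAlgebra A]
    {H : Type v} [NormedAddCommGroup H] [InnerProductSpace ℂ H] [CompleteSpace H]
    {K : Type w} [NormedAddCommGroup K] [InnerProductSpace ℂ K] [CompleteSpace K]
    (Φ : A → (H →L[ℂ] H)) (π : A →⋆ₐ[ℂ] (K →L[ℂ] K)) (V : H →L[ℂ] K) : Prop :=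
  (∀ X, Φ X = ContinuousLinearMap.adjoint V ∘L π X ∘L V) ∧
  (Submodule.span ℂ {k : K | ∃ X h, k = π X (V h)}).topologicalClosure = ⊤

/-! ### Local nets of observables -/

/-- Local normality of a functional on the global algebra, relative to a family of local algebras:
the restriction to each of these is normal. -/
def IsLocallyNormal {A : Type u} [CStarAlgebra A] (regions : Set (Set M4))
    (alg : Set M4 → StarSubalgebra ℂ A) (φ : A →ₗ[ℂ] ℂ) : Prop :=
  ∀ O ∈ regions, IsNormalFunctional (φ ∘ₗ (alg O).subtype.toAlgHom.toLinearMap)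

/-- A local net of `W⋆`-algebras with global `C⋆`-algebra `A`. The values `alg O` are meaningful
only for `O ∈ regions`. -/
structure LocalNet (A : Type u) [CStarAlgebra A] where
  /-- The index set of bounded regions. -/
  regions : Set (Set M4)
  nonempty_of_mem : ∀ O ∈ regions, O.Nonempty
  bounded_of_mem : ∀ O ∈ regions, Bornology.IsBounded O
  doubleCone_mem : ∀ O, IsDoubleCone O → O ∈ regions
  image_mem : ∀ (g : Poincare), ∀ O ∈ regions, poincareImage g O ∈ regions
  /-- The local algebras, with the unit of `A`. -/
  alg : Set M4 → StarSubalgebra ℂ A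
  isClosed_alg : ∀ O ∈ regions, IsClosed (alg O : Set A)
  wstar : ∀ (O) (hO : O ∈ regions),
    haveI : IsClosed (alg O : Set A) := isClosed_alg O hO
    WStarAlgebra (alg O)
  isotony : ∀ O₁ ∈ regions, ∀ O₂ ∈ regions, O₁ ⊆ O₂ → alg O₁ ≤ alg O₂
  locality : ∀ O₁ ∈ regions, ∀ O₂ ∈ regions, CausallySeparated O₁ O₂ →
    ∀ X ∈ alg O₁, ∀ Y ∈ alg O₂, Commute X Y
  dense : Dense (⋃ O ∈ regions, (alg O : Set A))
  /-- The action of the Poincare group. -/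
  α : Poincare →* (A ≃⋆ₐ[ℂ] A)
  covariance : ∀ (g : Poincare), ∀ O ∈ regions, α g '' (alg O : Set A) = alg (poincareImage g O)
  /-- Strong continuity, in the topology given by the seminorms `X ↦ φ(X⋆ X)^(1/2)` with `φ`
  positive and locally normal. -/
  continuous_action : ∀ φ : A →ₗ[ℂ] ℂ, IsPositiveFunctional φ → IsLocallyNormal regions alg φ →
    ∀ (X : A) (g₀ : Poincare),
      Tendsto (fun g => φ (star (α g X - α g₀ X) * (α g X - α g₀ X))) (𝓝 g₀) (𝓝 0)

namespace LocalNet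

variable {A : Type u} [CStarAlgebra A] (𝔄 : LocalNet A)
  {H : Type v} [NormedAddCommGroup H] [InnerProductSpace ℂ H] [CompleteSpace H]

/-- The `C⋆`-algebra `A(O')` generated by the local algebras of regions in the causal complement
of `O`. -/
def complAlg (O : Set M4) : StarSubalgebra ℂ A :=
  (StarAlgebra.adjoin ℂ (⋃ O₁ ∈ {O₁ ∈ 𝔄.regions | O₁ ⊆ causalComplement O},
    (𝔄.alg O₁ : Set A))).topologicalClosure

/-- Pairs `Λ = (O₁, O₂)` of regions such that the closure of `O₁` is properly contained in `O₂`. -/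
def inclusionPairs : Set (Set M4 × Set M4) :=
  {Λ | Λ.1 ∈ 𝔄.regions ∧ Λ.2 ∈ 𝔄.regions ∧ closure Λ.1 ⊂ Λ.2}

/-- Inclusion pairs of double cones. -/
def doubleConePairs : Set (Set M4 × Set M4) :=
  {Λ | Λ ∈ 𝔄.inclusionPairs ∧ IsDoubleCone Λ.1 ∧ IsDoubleCone Λ.2}

/-- Property B: nonzero projections of the inner algebra are equivalent to `1` in the outer one. -/
def PropertyB : Prop :=
  ∀ Λ ∈ 𝔄.inclusionPairs, ∀ E ∈ 𝔄.alg Λ.1, IsStarProjection E → E ≠ 0 →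
    ∃ W ∈ 𝔄.alg Λ.2, star W * W = 1 ∧ W * star W = E

/-- The dual `π^d(O) = π(A(O'))'` of the net in a representation. -/
def dual (π : A →⋆ₐ[ℂ] (H →L[ℂ] H)) (O : Set M4) : Set (H →L[ℂ] H) :=
  centralizer (π '' (𝔄.complAlg O : Set A))

/-- Haag duality: `π(A(O'))' = π(A(O))''` for all double cones. -/
def HaagDuality (π : A →⋆ₐ[ℂ] (H →L[ℂ] H)) : Prop :=
  ∀ O, IsDoubleCone O → 𝔄.dual π O = centralizer (centralizer (π '' (𝔄.alg O : Set A)))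

/-- Property DHR of a representation. -/
def PropertyDHR (π : A →⋆ₐ[ℂ] (H →L[ℂ] H)) : Prop :=
  ∀ Λ ∈ 𝔄.doubleConePairs, ∀ E ∈ 𝔄.dual π Λ.1, IsStarProjection E → E ≠ 0 →
    ∃ W ∈ 𝔄.dual π Λ.2, star W * W = 1 ∧ W * star W = E

/-- `ω` is a vacuum state with GNS representation `(π, H, Ω)`: a locally normal Poincare invariant
state whose GNS representation is irreducible and carries a strongly continuous unitary
representation `U` of the universal covering group `ℝ⁴ ⋊ SL(2, ℂ)`, fixing `Ω` and implementing the
action; `Ω` is cyclic and separating for every local algebra; and the joint spectrum of the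
generators of the translations lies in the closed forward cone. The last condition is expressed by
the spectral measures of vectors: `⟪ψ, U(a) ψ⟫ = ∫ exp(i p·a) dμ_ψ(p)` with `μ_ψ` carried by the
closed forward cone. -/
structure IsVacuum (ω : A →ₗ[ℂ] ℂ) (π : A →⋆ₐ[ℂ] (H →L[ℂ] H)) (Ω : H) : Prop where
  isState : IsState ω
  locallyNormal : IsLocallyNormal 𝔄.regions 𝔄.alg ω
  invariant : ∀ (g : Poincare) (X : A), ω (𝔄.α g X) = ω X
  gns : ∀ X, ω X = ⟪Ω, π X Ω⟫_ℂ
  gns_cyclic : Dense (range fun X => π X Ω)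
  irreducible : ∀ Y ∈ centralizer (range π), ∃ c : ℂ, Y = c • (1 : H →L[ℂ] H)
  cyclic : ∀ O ∈ 𝔄.regions, Dense ((fun X => π X Ω) '' (𝔄.alg O : Set A))
  separating : ∀ O ∈ 𝔄.regions, ∀ X ∈ 𝔄.alg O, π X Ω = 0 → π X = 0
  exists_unitary_rep : ∃ U : M4 → Matrix.SpecialLinearGroup (Fin 2) ℂ → unitary (H →L[ℂ] H),
    (∀ a b S T, U (a + spinAct S b) (S * T) = U a S * U b T) ∧
    (∀ ψ : H, Continuous fun p : M4 × Matrix.SpecialLinearGroup (Fin 2) ℂ =>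
      (U p.1 p.2 : H →L[ℂ] H) ψ) ∧
    (∀ a S, (U a S : H →L[ℂ] H) Ω = Ω) ∧
    (∀ a S (g : Poincare), LiesOver a S g → ∀ X,
      π (𝔄.α g X) = (U a S : H →L[ℂ] H) * π X * star (U a S : H →L[ℂ] H)) ∧
    ∀ ψ : H, ∃ μ : Measure M4, IsFiniteMeasure μ ∧ μ closedForwardConeᶜ = 0 ∧
      ∀ a, ⟪ψ, (U a 1 : H →L[ℂ] H) ψ⟫_ℂ = ∫ p, Complex.exp (Complex.I * (mink p a : ℂ)) ∂μ

/-- Local states with inclusion pair `Λ`: unital completely positive maps `T` on `A` with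
`T(AB) = T(A)B` for `B ∈ A(O₂')` which are given on `A(O₁)` by a normal state. -/
def IsLocalState [PartialOrder A] [StarOrderedRing A] (Λ : Set M4 × Set M4) (T : A →CP A) : Prop :=
  T 1 = 1 ∧ (∀ X, ∀ B ∈ 𝔄.complAlg Λ.2, T (X * B) = T X * B) ∧
  ∃ φ : 𝔄.alg Λ.1 →ₗ[ℂ] ℂ, IsState φ ∧ IsNormalFunctional φ ∧
    ∀ X : 𝔄.alg Λ.1, T (X : A) = φ X • (1 : A)

/-- A star endomorphism of `π(A)` is localized with support in `O` if it is the identity on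
`π(A(O'))`. -/
def IsLocalized (π : A →⋆ₐ[ℂ] (H →L[ℂ] H)) (O : Set M4) (ρ : π.range →⋆ₐ[ℂ] π.range) : Prop :=
  ∀ X ∈ 𝔄.complAlg O, ρ (π.rangeRestrict X) = π.rangeRestrict X

/-- A localized endomorphism with support in `O` is transportable if, for every `a`, it is of the
form `Ad U ∘ ρ'` with `ρ'` localized in `O + a` and `U` a unitary of `π(A)''`. -/
def IsTransportable (π : A →⋆ₐ[ℂ] (H →L[ℂ] H)) (O : Set M4) (ρ : π.range →⋆ₐ[ℂ] π.range) : Prop :=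
  ∀ a : M4, ∃ ρ' : π.range →⋆ₐ[ℂ] π.range, 𝔄.IsLocalized π (translateRegion a O) ρ' ∧
    ∃ U ∈ unitary (H →L[ℂ] H), U ∈ centralizer (centralizer (range π)) ∧
      ∀ X : π.range, (ρ X : H →L[ℂ] H) = U * (ρ' X : H →L[ℂ] H) * star U

/-- The representation `ρ ∘ π` of `A`. -/
def endoRep (π : A →⋆ₐ[ℂ] (H →L[ℂ] H)) (ρ : π.range →⋆ₐ[ℂ] π.range) : A →⋆ₐ[ℂ] (H →L[ℂ] H) :=
  π.range.subtype.comp (ρ.comp π.rangeRestrict)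

/-- `ρ` is a localized endomorphism with support in `O` that corresponds to `T`:
for some `V ∈ π^d(O)`, `(ρ ∘ π, V)` is a minimal Stinespring representation of `π ∘ T`; in
particular `π (T X) = V⋆ ρ(π X) V`. -/
def Corresponds [PartialOrder A] [StarOrderedRing A] (π : A →⋆ₐ[ℂ] (H →L[ℂ] H)) (O : Set M4)
    (T : A →CP A) (ρ : π.range →⋆ₐ[ℂ] π.range) : Prop :=
  𝔄.IsLocalized π O ρ ∧
    ∃ V ∈ 𝔄.dual π O, IsMinimalStinespring (fun X => π (T X)) (endoRep π ρ) V

/-- The localized endomorphisms corresponding to a local state `T` with outer region `O₂` are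
transportable. All corresponding localized endomorphisms with support in a double cone that
contains `O₂` are meant; their existence is not part of the condition, and any two of them are
unitarily equivalent. -/
def HasTransportableEndomorphisms [PartialOrder A] [StarOrderedRing A]
    (π : A →⋆ₐ[ℂ] (H →L[ℂ] H)) (O₂ : Set M4) (T : A →CP A) : Prop :=
  ∀ O, IsDoubleCone O → O₂ ⊆ O → ∀ ρ : π.range →⋆ₐ[ℂ] π.range,
    𝔄.Corresponds π O T ρ → 𝔄.IsTransportable π O ρ

end LocalNet

end

/-! Property B and normality make `π₀` faithful with von Neumann local algebras, so that Haag
duality reads `π₀^d(O) = π₀(A(O))`. Light rays `l`, `m` bounding a wedge that separates the two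
regions give directions in which the supports of the two endomorphisms can be moved apart
indefinitely, inside two double cones `Q₁`, `Q₂` that stay causally separated from each other. By
transportability, `π₀(T_j X) = W_j† π₀(X) W_j` for all observables `X` spacelike to the translated
support. Since `T_j` fixes the observables spacelike to `Q_j`, the operator `W_j` lies in
`π₀^d(Q_j)`, so `W₁` and `W₂` commute. Any given local observable becomes spacelike to both supports
once they are far enough away, hence `T₁` and `T₂` commute on it, and local observables are dense.
-/

/-! ### Light rays and double cones -/

/-- The length of the spatial part of a vector. The forward cones are given by
`spatialNorm x < x 0` and `spatialNorm x ≤ x 0`, which linearizes them along light rays. -/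
noncomputable def spatialNorm (x : M4) : ℝ := √(x 1 ^ 2 + x 2 ^ 2 + x 3 ^ 2)

/-- The future null vectors, normalized to have time component `1`. -/
def lightRays : Set M4 := {l | l 0 = 1 ∧ l 1 ^ 2 + l 2 ^ 2 + l 3 ^ 2 = 1}

/-- The open double cone with tips `p` and `q`; it is empty unless `q - p ∈ forwardCone`. -/
def doubleCone (p q : M4) : Set M4 := {x | x - p ∈ forwardCone ∧ q - x ∈ forwardCone}

theorem mink_comm (x y : M4) : mink x y = mink y x := by
  simp only [mink]; ring

theorem mink_add_left (x y z : M4) : mink (x + y) z = mink x z + mink y z := by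
  simp only [mink, Pi.add_apply]; ring

theorem mink_sub_left (x y z : M4) : mink (x - y) z = mink x z - mink y z := by
  simp only [mink, Pi.sub_apply]; ring

theorem mink_smul_left (c : ℝ) (x z : M4) : mink (c • x) z = c * mink x z := by
  simp only [mink, Pi.smul_apply, smul_eq_mul]; ring

theorem mink_smul_smul_self (c : ℝ) (x : M4) : mink (c • x) (c • x) = c ^ 2 * mink x x := by
  simp only [mink, Pi.smul_apply, smul_eq_mul]; ring

theorem mink_sub_self_comm (x y : M4) : mink (x - y) (x - y) = mink (y - x) (y - x) := by
  simp only [mink, Pi.sub_apply]; ring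

theorem continuous_mink_self : Continuous fun x : M4 => mink x x := by
  unfold mink; fun_prop

theorem mink_self_of_mem_lightRays {l : M4} (hl : l ∈ lightRays) : mink l l = 0 := by
  obtain ⟨h0, h⟩ := hl
  simp only [mink, h0]; linarith

theorem mink_lightRays_pos {l m : M4} (hl : l ∈ lightRays) (hm : m ∈ lightRays) (hne : l ≠ m) :
    0 < mink l m := by
  obtain ⟨l0, h⟩ := hl
  obtain ⟨m0, h'⟩ := hm
  have hdist : mink l m = ((l 1 - m 1) ^ 2 + (l 2 - m 2) ^ 2 + (l 3 - m 3) ^ 2) / 2 := by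
    simp only [mink, l0, m0]; linarith
  rw [hdist]
  refine lt_of_le_of_ne (by positivity) fun h0 => hne ?_
  have h1 : (l 1 - m 1) ^ 2 = 0 := by nlinarith
  have h2 : (l 2 - m 2) ^ 2 = 0 := by nlinarith
  have h3 : (l 3 - m 3) ^ 2 = 0 := by nlinarith
  simp only [sq_eq_zero_iff, sub_eq_zero] at h1 h2 h3
  ext i
  fin_cases i <;> simp [*]

theorem mem_forwardCone_iff_spatialNorm_lt {x : M4} : x ∈ forwardCone ↔ spatialNorm x < x 0 := by
  constructor
  · rintro ⟨hx, hx0⟩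
    refine (Real.sqrt_lt' hx0).2 ?_
    simp only [mink] at hx
    linarith
  · intro h
    have hx0 : 0 < x 0 := (Real.sqrt_nonneg _).trans_lt h
    have hsq := (Real.sqrt_lt' hx0).1 h
    refine ⟨?_, hx0⟩
    simp only [mink]
    linarith

theorem mem_closedForwardCone_iff_spatialNorm_le {x : M4} :
    x ∈ closedForwardCone ↔ spatialNorm x ≤ x 0 := by
  simp only [closedForwardCone, mink, spatialNorm, Real.sqrt_le_iff, mem_ofPred_eq]
  constructor <;> rintro ⟨h, h'⟩ <;> constructor <;> linarith

theorem sub_spatialNorm_le_mink {l : M4} (hl : l ∈ lightRays) (x : M4) :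
    x 0 - spatialNorm x ≤ mink x l := by
  obtain ⟨l0, hl⟩ := hl
  have cauchy_schwarz : (x 1 * l 1 + x 2 * l 2 + x 3 * l 3) ^ 2 ≤
      (x 1 ^ 2 + x 2 ^ 2 + x 3 ^ 2) * (l 1 ^ 2 + l 2 ^ 2 + l 3 ^ 2) := by
    nlinarith [sq_nonneg (x 1 * l 2 - x 2 * l 1), sq_nonneg (x 1 * l 3 - x 3 * l 1),
      sq_nonneg (x 2 * l 3 - x 3 * l 2)]
  rw [hl, mul_one] at cauchy_schwarz
  have h := (le_abs_self _).trans (Real.abs_le_sqrt cauchy_schwarz)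
  simp only [mink, spatialNorm, l0]
  linarith

theorem exists_mink_eq_sub_spatialNorm (x : M4) :
    ∃ l ∈ lightRays, mink x l = x 0 - spatialNorm x := by
  have hsq : spatialNorm x ^ 2 = x 1 ^ 2 + x 2 ^ 2 + x 3 ^ 2 := Real.sq_sqrt (by positivity)
  by_cases h : spatialNorm x = 0
  · have h1 : x 1 ^ 2 = 0 := by rw [h] at hsq; nlinarith
    rw [sq_eq_zero_iff] at h1
    exact ⟨![1, 1, 0, 0], ⟨by simp, by simp⟩, by simp [mink, h, h1]⟩
  · refine ⟨![1, x 1 / spatialNorm x, x 2 / spatialNorm x, x 3 / spatialNorm x], ⟨by simp, ?_⟩, ?_⟩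
    · simp only [Matrix.cons_val]
      field_simp
      exact hsq.symm
    · simp only [mink, Matrix.cons_val]
      field_simp
      linarith

theorem mem_forwardCone_iff {x : M4} : x ∈ forwardCone ↔ ∀ l ∈ lightRays, 0 < mink x l := by
  rw [mem_forwardCone_iff_spatialNorm_lt]
  refine ⟨fun h l hl => (sub_pos.2 h).trans_le (sub_spatialNorm_le_mink hl x), fun h => ?_⟩
  obtain ⟨l, hl, hxl⟩ := exists_mink_eq_sub_spatialNorm x
  exact sub_pos.1 (hxl ▸ h l hl)

theorem mem_closedForwardCone_iff {x : M4} :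
    x ∈ closedForwardCone ↔ ∀ l ∈ lightRays, 0 ≤ mink x l := by
  rw [mem_closedForwardCone_iff_spatialNorm_le]
  refine ⟨fun h l hl => (sub_nonneg.2 h).trans (sub_spatialNorm_le_mink hl x), fun h => ?_⟩
  obtain ⟨l, hl, hxl⟩ := exists_mink_eq_sub_spatialNorm x
  exact sub_nonneg.1 (hxl ▸ h l hl)

theorem lightRays_subset_closedForwardCone : lightRays ⊆ closedForwardCone :=
  fun _ hl => ⟨(mink_self_of_mem_lightRays hl).ge, hl.1.symm ▸ zero_le_one⟩

theorem isOpen_forwardCone : IsOpen forwardCone :=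
  (isOpen_lt continuous_const continuous_mink_self).inter
    (isOpen_lt continuous_const (continuous_apply 0))

theorem add_mem_forwardCone {x y : M4} (hx : x ∈ forwardCone) (hy : y ∈ closedForwardCone) :
    x + y ∈ forwardCone := by
  rw [mem_forwardCone_iff] at *
  rw [mem_closedForwardCone_iff] at hy
  intro l hl
  rw [mink_add_left]
  exact add_pos_of_pos_of_nonneg (hx l hl) (hy l hl)

theorem smul_mem_forwardCone {c : ℝ} (hc : 0 < c) {x : M4} (hx : x ∈ forwardCone) :
    c • x ∈ forwardCone := by
  rw [mem_forwardCone_iff] at *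
  intro l hl
  rw [mink_smul_left]
  exact mul_pos hc (hx l hl)

theorem smul_mem_closedForwardCone {c : ℝ} (hc : 0 ≤ c) {x : M4} (hx : x ∈ closedForwardCone) :
    c • x ∈ closedForwardCone := by
  rw [mem_closedForwardCone_iff] at *
  intro l hl
  rw [mink_smul_left]
  exact mul_nonneg hc (hx l hl)

theorem add_mem_forwardCone_of_mem_lightRays {l m : M4} (hl : l ∈ lightRays) (hm : m ∈ lightRays)
    (hlm : 0 < mink l m) : l + m ∈ forwardCone := by
  have hself : mink (l + m) (l + m) = mink l l + 2 * mink l m + mink m m := by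
    simp only [mink, Pi.add_apply]; ring
  refine ⟨?_, ?_⟩
  · rw [hself, mink_self_of_mem_lightRays hl, mink_self_of_mem_lightRays hm]
    linarith
  · rw [Pi.add_apply, hl.1, hm.1]
    norm_num

theorem mink_sub_self_neg_of_mem_lightRays {l m : M4} (hl : l ∈ lightRays) (hm : m ∈ lightRays)
    (hlm : 0 < mink l m) : mink (l - m) (l - m) < 0 := by
  have hself : mink (l - m) (l - m) = mink l l - 2 * mink l m + mink m m := by
    simp only [mink, Pi.sub_apply]; ring
  rw [hself, mink_self_of_mem_lightRays hl, mink_self_of_mem_lightRays hm]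
  linarith

theorem mink_self_neg_of_wedge {x l m : M4} (hl : l ∈ lightRays) (hm : m ∈ lightRays)
    (hxl : mink x l < 0) (hxm : 0 < mink x m) : mink x x < 0 := by
  by_contra! hx
  have hneg (y : M4) : mink (0 - x) y = -mink x y := by simp [mink]; ring
  rcases le_total 0 (x 0) with h0 | h0
  · exact hxl.not_ge (mem_closedForwardCone_iff.1 ⟨hx, h0⟩ l hl)
  · have hmem : 0 - x ∈ closedForwardCone :=
      ⟨by rwa [← mink_sub_self_comm, sub_zero], by simpa using h0⟩
    have := mem_closedForwardCone_iff.1 hmem m hm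
    rw [hneg] at this
    linarith

theorem eventually_smul_sub_mem {E : Type*} [NormedAddCommGroup E] [NormedSpace ℝ E] {C : Set E}
    (hC : IsOpen C) (hsmul : ∀ c : ℝ, 0 < c → ∀ x ∈ C, c • x ∈ C) {x : E} (hx : x ∈ C)
    {s : Set E} (hs : Bornology.IsBounded s) : ∀ᶠ t : ℝ in atTop, ∀ y ∈ s, t • x - y ∈ C := by
  have hU : {z | x - z ∈ C} ∈ 𝓝 (0 : E) :=
    (hC.preimage (continuous_const.sub continuous_id)).mem_nhds (by simpa using hx)
  have habs : Absorbs ℝ {z | x - z ∈ C} s := NormedSpace.isVonNBounded_of_isBounded ℝ hs hU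
  filter_upwards [IsOrderBornology.atTop_le_cobounded habs, eventually_gt_atTop 0] with t ht ht0
  intro y hy
  obtain ⟨z, hz, rfl⟩ := ht hy
  simpa only [smul_sub] using hsmul t ht0 _ hz

theorem isDoubleCone_doubleCone {p q : M4} (h : q - p ∈ forwardCone) :
    IsDoubleCone (doubleCone p q) := ⟨p, q, h, rfl⟩

theorem doubleCone_subset {p q p' q' : M4} (hp : p - p' ∈ closedForwardCone)
    (hq : q' - q ∈ closedForwardCone) : doubleCone p q ⊆ doubleCone p' q' := by
  rintro x ⟨hpx, hxq⟩
  exact ⟨sub_add_sub_cancel x p p' ▸ add_mem_forwardCone hpx hp,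
    sub_add_sub_cancel' q x q' ▸ add_mem_forwardCone hxq hq⟩

theorem exists_isDoubleCone_superset {s : Set M4} (hs : Bornology.IsBounded s) :
    ∃ O, IsDoubleCone O ∧ s ⊆ O := by
  obtain ⟨e, he⟩ : forwardCone.Nonempty := ⟨![1, 0, 0, 0], by simp [forwardCone, mink]⟩
  have habs := eventually_smul_sub_mem isOpen_forwardCone (fun c hc x => smul_mem_forwardCone hc) he
    (hs.union hs.neg)
  obtain ⟨r, hr, hr0⟩ := (habs.and (eventually_gt_atTop 0)).exists
  refine ⟨doubleCone (-(r • e)) (r • e), isDoubleCone_doubleCone ?_, fun x hx => ⟨?_, ?_⟩⟩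
  · rw [sub_neg_eq_add, ← add_smul]
    exact smul_mem_forwardCone (add_pos hr0 hr0) he
  · simpa [add_comm] using hr (-x) (Or.inr (by simpa using hx))
  · exact hr x (Or.inl hx)

theorem exists_isDoubleCone_closure_ssubset {s : Set M4} (hs : Bornology.IsBounded s) :
    ∃ O, IsDoubleCone O ∧ closure s ⊂ O := by
  obtain ⟨z, hz⟩ : ∃ z, z ∉ closure s := by
    by_contra! h
    exact NormedSpace.unbounded_univ ℝ M4 (eq_univ_of_forall h ▸ hs.closure)
  obtain ⟨O, hO, hsub⟩ := exists_isDoubleCone_superset (hs.closure.insert z)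
  exact ⟨O, hO, (subset_insert _ _).trans hsub, fun h => hz (h (hsub (mem_insert _ _)))⟩

theorem CausallySeparated.symm {O₁ O₂ : Set M4} (h : CausallySeparated O₁ O₂) :
    CausallySeparated O₂ O₁ := fun y hy x hx => by
  rw [mink_sub_self_comm]; exact h hx y hy

theorem causallySeparated_doubleCone {p q p' q' l m : M4} (hl : l ∈ lightRays)
    (hm : m ∈ lightRays) (hql : mink (q - p') l ≤ 0) (hpm : 0 ≤ mink (p - q') m) :
    CausallySeparated (doubleCone p q) (doubleCone p' q') := by
  rintro x ⟨hpx, hxq⟩ y ⟨hpy, hyq⟩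
  rw [mem_forwardCone_iff] at hpx hxq hpy hyq
  have hxql := hxq l hl
  have hpyl := hpy l hl
  have hpxm := hpx m hm
  have hyqm := hyq m hm
  rw [mink_sub_left] at hql hpm hxql hpyl hpxm hyqm
  refine mink_self_neg_of_wedge hl hm ?_ ?_ <;> rw [mink_sub_left] <;> linarith

/-- If `q` were in the future of `p'`, then so would be a point of the first double cone close to
`q`, relative to a point of the second one close to `p'`. -/
theorem CausallySeparated.sub_notMem_forwardCone {p q p' q' : M4} (h : q - p ∈ forwardCone)
    (h' : q' - p' ∈ forwardCone)
    (hsep : CausallySeparated (doubleCone p q) (doubleCone p' q')) :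
    q - p' ∉ forwardCone := by
  intro hmem
  have hcont : Continuous fun t : ℝ => (q - t • (q - p)) - (p' + t • (q' - p')) := by fun_prop
  have hnear : ∀ᶠ t in 𝓝[>] (0 : ℝ), (q - t • (q - p)) - (p' + t • (q' - p')) ∈ forwardCone := by
    refine (hcont.continuousAt.eventually ?_).filter_mono nhdsWithin_le_nhds
    simpa using isOpen_forwardCone.mem_nhds hmem
  obtain ⟨t, ht, ht0, ht1⟩ := (hnear.and (Ioo_mem_nhdsGT (zero_lt_one' ℝ))).exists
  have hx : q - t • (q - p) ∈ doubleCone p q := by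
    refine ⟨?_, ?_⟩
    · convert smul_mem_forwardCone (sub_pos.2 ht1) h using 1; module
    · simpa using smul_mem_forwardCone ht0 h
  have hy : p' + t • (q' - p') ∈ doubleCone p' q' := by
    refine ⟨?_, ?_⟩
    · simpa using smul_mem_forwardCone ht0 h'
    · convert smul_mem_forwardCone (sub_pos.2 ht1) h' using 1; module
  exact lt_asymm (hsep hx _ hy) ht.1

theorem CausallySeparated.exists_wedge {p q p' q' : M4} (h : q - p ∈ forwardCone)
    (h' : q' - p' ∈ forwardCone)
    (hsep : CausallySeparated (doubleCone p q) (doubleCone p' q')) :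
    ∃ l ∈ lightRays, ∃ m ∈ lightRays, 0 < mink l m ∧ mink (q - p') l ≤ 0 ∧
      0 ≤ mink (p - q') m := by
  have exists_nonpos {x : M4} (hx : x ∉ forwardCone) : ∃ l ∈ lightRays, mink x l ≤ 0 := by
    simpa [mem_forwardCone_iff] using hx
  obtain ⟨l, hl, hql⟩ := exists_nonpos (hsep.sub_notMem_forwardCone h h')
  obtain ⟨m, hm, hqm⟩ := exists_nonpos (hsep.symm.sub_notMem_forwardCone h' h)
  refine ⟨l, hl, m, hm, mink_lightRays_pos hl hm ?_, hql, ?_⟩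
  · rintro rfl
    have hpq := mem_forwardCone_iff.1 h l hl
    have hpq' := mem_forwardCone_iff.1 h' l hl
    simp only [mink_sub_left] at *
    linarith
  · simp only [mink_sub_left] at *
    linarith

open scoped Pointwise in
theorem eventually_translateRegion_subset_doubleCone {l m : M4} (hlm : l + m ∈ forwardCone)
    {O : Set M4} (hO : Bornology.IsBounded O) (p q : M4) :
    ∀ᶠ t : ℝ in atTop,
      translateRegion (t • (l - m)) O ⊆ doubleCone (p - (2 * t) • m) (q + (2 * t) • l) := by
  have hfar {s : Set M4} (hs : Bornology.IsBounded s) :=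
    eventually_smul_sub_mem isOpen_forwardCone (fun c hc x => smul_mem_forwardCone hc) hlm hs
  filter_upwards [hfar (Bornology.isBounded_singleton.sub hO : Bornology.IsBounded ({p} - O)),
    hfar (hO.sub Bornology.isBounded_singleton : Bornology.IsBounded (O - {q}))] with t hp hq
  rintro _ ⟨x, hx, rfl⟩
  refine ⟨?_, ?_⟩
  · convert hp _ (sub_mem_sub rfl hx) using 1; module
  · convert hq _ (sub_mem_sub hx rfl) using 1; module

open scoped Pointwise in
theorem eventually_causallySeparated_translateRegion {a : M4} (ha : mink a a < 0) {R O : Set M4}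
    (hR : Bornology.IsBounded R) (hO : Bornology.IsBounded O) :
    ∀ᶠ t : ℝ in atTop, CausallySeparated R (translateRegion (t • a) O) := by
  have hopen : IsOpen {x : M4 | mink x x < 0} := isOpen_lt continuous_mink_self continuous_const
  have hsmul (c : ℝ) (hc : 0 < c) (x : M4) (hx : mink x x < 0) : mink (c • x) (c • x) < 0 := by
    rw [mink_smul_smul_self]
    exact mul_neg_of_pos_of_neg (pow_pos hc 2) hx
  filter_upwards [eventually_smul_sub_mem hopen hsmul ha (hR.sub hO)] with t ht x hx
  rintro _ ⟨y, hy, rfl⟩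
  rw [mink_sub_self_comm, show y + t • a - x = t • a - (x - y) by abel]
  exact ht _ (sub_mem_sub hx hy)

/-- The two regions are moved along the axis `l - m` of a separating wedge, while the tips of the
double cones that contain them recede along its light rays `l` and `m`. -/
theorem CausallySeparated.exists_moving_apart {D D' : Set M4} (hD : IsDoubleCone D)
    (hD' : IsDoubleCone D') (hsep : CausallySeparated D D') {O O' R : Set M4}
    (hO : Bornology.IsBounded O) (hO' : Bornology.IsBounded O') (hR : Bornology.IsBounded R) :
    ∃ (a : M4) (Q Q' : Set M4), IsDoubleCone Q ∧ IsDoubleCone Q' ∧ CausallySeparated Q Q' ∧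
      D ⊆ Q ∧ D' ⊆ Q' ∧ translateRegion a O ⊆ Q ∧ translateRegion (-a) O' ⊆ Q' ∧
      CausallySeparated R (translateRegion a O) ∧
      CausallySeparated R (translateRegion (-a) O') := by
  obtain ⟨p, q, h, rfl⟩ := hD
  obtain ⟨p', q', h', rfl⟩ := hD'
  obtain ⟨l, hl, m, hm, hlm, hql, hpm⟩ := hsep.exists_wedge h h'
  have hml : 0 < mink m l := mink_comm l m ▸ hlm
  obtain ⟨t, ht0, hsub, hsub', hRO, hRO'⟩ := ((eventually_ge_atTop 0).and
    ((eventually_translateRegion_subset_doubleCone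
      (add_mem_forwardCone_of_mem_lightRays hl hm hlm) hO p q).and
    ((eventually_translateRegion_subset_doubleCone
      (add_mem_forwardCone_of_mem_lightRays hm hl hml) hO' p' q').and
    ((eventually_causallySeparated_translateRegion
      (mink_sub_self_neg_of_mem_lightRays hl hm hlm) hR hO).and
    (eventually_causallySeparated_translateRegion
      (mink_sub_self_neg_of_mem_lightRays hm hl hml) hR hO'))))).exists
  have hneg : -(t • (l - m)) = t • (m - l) := by module
  have hl2 := smul_mem_closedForwardCone (mul_nonneg zero_le_two ht0)
    (lightRays_subset_closedForwardCone hl)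
  have hm2 := smul_mem_closedForwardCone (mul_nonneg zero_le_two ht0)
    (lightRays_subset_closedForwardCone hm)
  refine ⟨t • (l - m), doubleCone (p - (2 * t) • m) (q + (2 * t) • l),
    doubleCone (p' - (2 * t) • l) (q' + (2 * t) • m), isDoubleCone_doubleCone ?_,
    isDoubleCone_doubleCone ?_, causallySeparated_doubleCone hl hm ?_ ?_,
    doubleCone_subset (by simpa using hm2) (by simpa using hl2),
    doubleCone_subset (by simpa using hl2) (by simpa using hm2), hsub, hneg ▸ hsub', hRO,
    hneg ▸ hRO'⟩
  · convert add_mem_forwardCone (add_mem_forwardCone h hl2) hm2 using 1; abel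
  · convert add_mem_forwardCone (add_mem_forwardCone h' hl2) hm2 using 1; abel
  · simpa [mink_sub_left, mink_add_left, mink_smul_left, mink_self_of_mem_lightRays hl] using hql
  · simpa [mink_sub_left, mink_add_left, mink_smul_left, mink_self_of_mem_lightRays hm] using hpm

/-! ### Operators defined on total sets -/

section TotalSets

variable {K : Type*} [NormedAddCommGroup K] [InnerProductSpace ℂ K]
  {F : Type*} [NormedAddCommGroup F] [InnerProductSpace ℂ F]

theorem eq_of_eqOn_of_eqOn_orthogonal [CompleteSpace K] {f g : K →L[ℂ] F} {D : Set K}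
    (hD : EqOn f g D) (horth : EqOn f g (Submodule.span ℂ D)ᗮ) : f = g := by
  have hspan : Submodule.span ℂ (D ∪ (Submodule.span ℂ D)ᗮ) =
      Submodule.span ℂ D ⊔ (Submodule.span ℂ D)ᗮ := by
    rw [Submodule.span_union, Submodule.span_eq]
  refine ContinuousLinearMap.ext_on (s := D ∪ (Submodule.span ℂ D)ᗮ) ?_ (hD.union horth)
  rw [hspan, Submodule.dense_iff_topologicalClosure_eq_top,
    Submodule.topologicalClosure_eq_top_iff, ← Submodule.inf_orthogonal,
    Submodule.inf_orthogonal_eq_bot]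

theorem exists_clm_of_norm_le [CompleteSpace K] [CompleteSpace F] {E : Type*} [AddCommGroup E]
    [Module ℂ E] {f : E →ₗ[ℂ] F} {e : E →ₗ[ℂ] K} {C : ℝ} (h : ∀ x, ‖f x‖ ≤ C * ‖e x‖) :
    ∃ S : K →L[ℂ] F, (∀ x, S (e x) = f x) ∧ ∀ k ∈ (LinearMap.range e)ᗮ, S k = 0 := by
  let N := (LinearMap.range e).topologicalClosure
  have : CompleteSpace N := (Submodule.isClosed_topologicalClosure _).completeSpace_coe
  let e' : E →ₗ[ℂ] N := e.codRestrict N fun x => Submodule.le_topologicalClosure _ ⟨x, rfl⟩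
  have hdense : DenseRange e' := by
    rw [DenseRange, Subtype.dense_iff, ← range_comp]
    exact fun y hy => hy
  refine ⟨(f.extendOfNorm e') ∘L N.orthogonalProjectionOnto, fun x => ?_, fun k hk => ?_⟩
  · rw [ContinuousLinearMap.comp_apply,
      show N.orthogonalProjectionOnto (e x) = e' x from
        Submodule.orthogonalProjectionOnto_mem_subspace_eq_self (e' x)]
    exact LinearMap.extendOfNorm_eq hdense ⟨C, h⟩ x
  · rw [← Submodule.orthogonal_closure] at hk
    rw [ContinuousLinearMap.comp_apply,
      Submodule.orthogonalProjectionOnto_apply_of_mem_orthogonal hk, map_zero]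

theorem exists_clm_of_inner_eq [CompleteSpace K] [CompleteSpace F] {ι : Type*} {e : ι → K}
    {f : ι → F} (h : ∀ i j, ⟪f i, f j⟫_ℂ = ⟪e i, e j⟫_ℂ) :
    ∃ S : K →L[ℂ] F, (∀ i, S (e i) = f i) ∧ ∀ k ∈ (Submodule.span ℂ (range e))ᗮ, S k = 0 := by
  have hnorm (c : ι →₀ ℂ) :
      ‖Finsupp.linearCombination ℂ f c‖ = ‖Finsupp.linearCombination ℂ e c‖ := by
    have hinner : ⟪Finsupp.linearCombination ℂ f c, Finsupp.linearCombination ℂ f c⟫_ℂ =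
        ⟪Finsupp.linearCombination ℂ e c, Finsupp.linearCombination ℂ e c⟫_ℂ := by
      simp only [Finsupp.linearCombination_apply, Finsupp.sum_inner, Finsupp.inner_sum,
        inner_smul_left, inner_smul_right, h]
    rw [norm_eq_sqrt_re_inner (𝕜 := ℂ), hinner, ← norm_eq_sqrt_re_inner]
  obtain ⟨S, hS, hS0⟩ := exists_clm_of_norm_le (f := Finsupp.linearCombination ℂ f)
    (e := Finsupp.linearCombination ℂ e) (C := 1) fun c => by rw [hnorm, one_mul]
  refine ⟨S, fun i => ?_, by rwa [Finsupp.range_linearCombination] at hS0⟩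
  simpa using hS (Finsupp.single i 1)

end TotalSets

/-! ### Intertwiners -/

section Intertwiners

variable {M : Type*} [Ring M] [StarRing M] [Algebra ℂ M]
  {L : Type*} [NormedAddCommGroup L] [InnerProductSpace ℂ L] [CompleteSpace L]
  {H : Type*} [NormedAddCommGroup H] [InnerProductSpace ℂ H] [CompleteSpace H]
  {K : Type*} [NormedAddCommGroup K] [InnerProductSpace ℂ K] [CompleteSpace K]
  {σ : M →⋆ₐ[ℂ] (L →L[ℂ] L)} {π : M →⋆ₐ[ℂ] (H →L[ℂ] H)} {τ : M →⋆ₐ[ℂ] (K →L[ℂ] K)}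

/-- A bounded operator `t` intertwines the representations `π` and `σ`. -/
def Intertwines (π : M →⋆ₐ[ℂ] (H →L[ℂ] H)) (σ : M →⋆ₐ[ℂ] (L →L[ℂ] L)) (t : H →L[ℂ] L) : Prop :=
  ∀ X, t ∘L π X = σ X ∘L t

/-- The part of `L` that is reached from `π` by intertwiners into `σ`. -/
def intertwinerSpan (π : M →⋆ₐ[ℂ] (H →L[ℂ] H)) (σ : M →⋆ₐ[ℂ] (L →L[ℂ] L)) : Submodule ℂ L :=
  Submodule.span ℂ {k | ∃ t, Intertwines π σ t ∧ ∃ h, t h = k}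

/-- The representation `π` is quasi-contained in `σ`: the intertwiners from `π` to `σ` separate
the vectors of `π`. -/
def IsQuasiContained (π : M →⋆ₐ[ℂ] (H →L[ℂ] H)) (σ : M →⋆ₐ[ℂ] (L →L[ℂ] L)) : Prop :=
  ∀ h, (∀ t, Intertwines π σ t → t h = 0) → h = 0

theorem Intertwines.apply {t : H →L[ℂ] L} (ht : Intertwines π σ t) (X : M) (h : H) :
    t (π X h) = σ X (t h) := congr($(ht X) h)

theorem Intertwines.comp {s : L →L[ℂ] K} {t : H →L[ℂ] L} (hs : Intertwines σ τ s)
    (ht : Intertwines π σ t) : Intertwines π τ (s ∘L t) := fun X => by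
  rw [ContinuousLinearMap.comp_assoc, ht X, ← ContinuousLinearMap.comp_assoc, hs X,
    ContinuousLinearMap.comp_assoc]

theorem adjoint_map (π : M →⋆ₐ[ℂ] (H →L[ℂ] H)) (X : M) : (π X).adjoint = π (star X) := by
  rw [map_star, ContinuousLinearMap.star_eq_adjoint]

theorem Intertwines.adjoint {t : H →L[ℂ] L} (ht : Intertwines π σ t) :
    Intertwines σ π t.adjoint := fun X => by
  have h := congr(ContinuousLinearMap.adjoint $(ht (star X)))
  rw [ContinuousLinearMap.adjoint_comp, ContinuousLinearMap.adjoint_comp, adjoint_map, adjoint_map,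
    star_star] at h
  exact h.symm

theorem mem_centralizer_range_iff {T : H →L[ℂ] H} :
    T ∈ centralizer (range π) ↔ Intertwines π π T := by
  simp only [mem_centralizer_iff, forall_mem_range, Intertwines, ContinuousLinearMap.mul_def,
    eq_comm]

theorem star_mem_centralizer_range {T : H →L[ℂ] H} (hT : T ∈ centralizer (range π)) :
    star T ∈ centralizer (range π) :=
  mem_centralizer_range_iff.2 (mem_centralizer_range_iff.1 hT).adjoint

theorem Intertwines.apply_mem_intertwinerSpan {t : H →L[ℂ] L} (ht : Intertwines π σ t) (h : H) :
    t h ∈ intertwinerSpan π σ := Submodule.subset_span ⟨t, ht, h, rfl⟩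

theorem eq_of_comp_eq_of_eqOn_orthogonal {F : Type*} [NormedAddCommGroup F]
    [InnerProductSpace ℂ F] {f g : L →L[ℂ] F}
    (h : ∀ t, Intertwines π σ t → f ∘L t = g ∘L t)
    (h₀ : EqOn f g (intertwinerSpan π σ)ᗮ) : f = g := by
  refine eq_of_eqOn_of_eqOn_orthogonal ?_ h₀
  rintro _ ⟨t, ht, v, rfl⟩
  exact congr($(h t ht) v)

theorem map_mem_intertwinerSpan {T : L →L[ℂ] L} (hT : T ∈ centralizer (range σ)) {k : L}
    (hk : k ∈ intertwinerSpan π σ) : T k ∈ intertwinerSpan π σ := by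
  have hle : intertwinerSpan π σ ≤ (intertwinerSpan π σ).comap T.toLinearMap := by
    refine Submodule.span_le.2 ?_
    rintro _ ⟨t, ht, h, rfl⟩
    exact Submodule.subset_span ⟨T ∘L t, (mem_centralizer_range_iff.1 hT).comp ht, h, rfl⟩
  exact hle hk

theorem map_mem_orthogonal_intertwinerSpan {T : L →L[ℂ] L} (hT : T ∈ centralizer (range σ)) {k : L}
    (hk : k ∈ (intertwinerSpan π σ)ᗮ) : T k ∈ (intertwinerSpan π σ)ᗮ := fun d hd => by
  rw [← ContinuousLinearMap.adjoint_inner_left, ← ContinuousLinearMap.star_eq_adjoint]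
  exact hk _ (map_mem_intertwinerSpan (star_mem_centralizer_range hT) hd)

/-- The operator `t h ↦ t (U h)` is well defined and isometric on the vectors `t h`, because `U`
commutes with the operators `s† t` in the commutant of `π`, and it lies in the double commutant
of `σ`. -/
theorem IsVonNeumannRealization.exists_comp_eq (hσ : IsVonNeumannRealization σ) {U : H →L[ℂ] H}
    (hU : U ∈ unitary (H →L[ℂ] H)) (hUcc : U ∈ centralizer (centralizer (range π))) :
    ∃ x : M, (∀ t, Intertwines π σ t → σ x ∘L t = t ∘L U) ∧
      ∀ k ∈ (intertwinerSpan π σ)ᗮ, σ x k = 0 := by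
  let e (p : {t // Intertwines π σ t} × H) : L := p.1.1 p.2
  have hrange : range e = {k | ∃ t, Intertwines π σ t ∧ ∃ h, t h = k} := by
    ext k; simp [e]
  have hgram (p q : {t // Intertwines π σ t} × H) :
      ⟪p.1.1 (U p.2), q.1.1 (U q.2)⟫_ℂ = ⟪e p, e q⟫_ℂ := by
    have hcomm : p.1.1.adjoint (q.1.1 (U q.2)) = U (p.1.1.adjoint (q.1.1 q.2)) :=
      congr($(hUcc _ (mem_centralizer_range_iff.2 (p.1.2.adjoint.comp q.1.2))) q.2)
    have hisom (h k : H) : ⟪U h, U k⟫_ℂ = ⟪h, k⟫_ℂ := by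
      rw [← ContinuousLinearMap.adjoint_inner_right, ← ContinuousLinearMap.star_eq_adjoint]
      exact congr(⟪h, $(Unitary.star_mul_self_of_mem hU) k⟫_ℂ)
    rw [← ContinuousLinearMap.adjoint_inner_right, hcomm, hisom,
      ContinuousLinearMap.adjoint_inner_right]
  obtain ⟨S, hS, hS0⟩ := exists_clm_of_inner_eq hgram
  rw [hrange] at hS0
  have hSt {t : H →L[ℂ] L} (ht : Intertwines π σ t) (h : H) : S (t h) = t (U h) := hS (⟨t, ht⟩, h)
  have hScc : S ∈ centralizer (centralizer (range σ)) := by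
    refine fun T hT =>
      eq_of_comp_eq_of_eqOn_orthogonal (π := π) (σ := σ) (fun t ht => ?_) fun k hk => ?_
    · ext h
      have hTt := (mem_centralizer_range_iff.1 hT).comp ht
      change T (S (t h)) = S ((T ∘L t) h)
      rw [hSt ht, hSt hTt, ContinuousLinearMap.comp_apply]
    · change T (S k) = S (T k)
      rw [hS0 k hk, hS0 _ (map_mem_orthogonal_intertwinerSpan hT hk), map_zero]
  obtain ⟨x, rfl⟩ := hσ.2.subset hScc
  exact ⟨x, fun t ht => ContinuousLinearMap.ext (hSt ht), hS0⟩

theorem IsQuasiContained.ext (hπ : IsQuasiContained π σ) {f g : H →L[ℂ] H}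
    (h : ∀ t, Intertwines π σ t → t ∘L f = t ∘L g) : f = g := by
  ext k
  refine sub_eq_zero.1 (hπ _ fun t ht => ?_)
  rw [map_sub, sub_eq_zero]
  exact congr($(h t ht) k)

theorem Intertwines.starProjection_comp {t : H →L[ℂ] L} (ht : Intertwines π σ t) :
    (intertwinerSpan π σ).topologicalClosure.starProjection ∘L t = t :=
  ContinuousLinearMap.ext fun h => Submodule.starProjection_eq_self_iff.2
    (Submodule.le_topologicalClosure _ (ht.apply_mem_intertwinerSpan h))

theorem starProjection_intertwinerSpan_eq_zero {k : L} (hk : k ∈ (intertwinerSpan π σ)ᗮ) :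
    (intertwinerSpan π σ).topologicalClosure.starProjection k = 0 :=
  (Submodule.starProjection_apply_eq_zero_iff _).2 (by rwa [Submodule.orthogonal_closure])

theorem IsVonNeumannRealization.exists_map_eq_starProjection (hσ : IsVonNeumannRealization σ)
    (π : M →⋆ₐ[ℂ] (H →L[ℂ] H)) :
    ∃ e : M, σ e = (intertwinerSpan π σ).topologicalClosure.starProjection := by
  obtain ⟨e, he, he₀⟩ := hσ.exists_comp_eq (π := π) (one_mem (unitary (H →L[ℂ] H)))
    (one_mem (Submonoid.centralizer (centralizer (range π))))
  refine ⟨e, eq_of_comp_eq_of_eqOn_orthogonal (π := π) (σ := σ) (fun t ht => ?_) fun k hk => ?_⟩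
  · rw [ht.starProjection_comp, he t ht, ContinuousLinearMap.one_def, ContinuousLinearMap.comp_id]
  · rw [he₀ k hk, starProjection_intertwinerSpan_eq_zero hk]

theorem IsQuasiContained.comp_starProjection_eq_zero_iff (hπ : IsQuasiContained π σ) {X : M} :
    σ X ∘L (intertwinerSpan π σ).topologicalClosure.starProjection = 0 ↔ π X = 0 := by
  refine ⟨fun h₀ => hπ.ext fun t ht => ?_, fun h₀ =>
    eq_of_comp_eq_of_eqOn_orthogonal (π := π) (σ := σ) (fun t ht => ?_) fun k hk => ?_⟩
  · rw [ht X, ← ht.starProjection_comp, ← ContinuousLinearMap.comp_assoc, h₀,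
      ContinuousLinearMap.zero_comp, ContinuousLinearMap.comp_zero]
  · rw [ContinuousLinearMap.comp_assoc, ht.starProjection_comp, ← ht X, h₀,
      ContinuousLinearMap.zero_comp, ContinuousLinearMap.comp_zero]
  · rw [ContinuousLinearMap.comp_apply, starProjection_intertwinerSpan_eq_zero hk, map_zero,
      zero_apply]

theorem IsQuasiContained.exists_isStarProjection (hπ : IsQuasiContained π σ)
    (hσ : IsVonNeumannRealization σ) :
    ∃ e : M, IsStarProjection e ∧ ∀ X, X * e = 0 ↔ π X = 0 := by
  obtain ⟨e, he⟩ := hσ.exists_map_eq_starProjection π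
  have hproj : IsStarProjection (σ e) := he ▸ isStarProjection_starProjection
  refine ⟨e, ⟨hσ.1 ?_, hσ.1 ?_⟩, fun X => ?_⟩
  · rw [map_mul, hproj.isIdempotentElem.eq]
  · rw [map_star, hproj.isSelfAdjoint.star_eq]
  · rw [← map_eq_zero_iff σ hσ.1, map_mul, he]
    exact hπ.comp_starProjection_eq_zero_iff

theorem centralizer_centralizer_range_subset_of_unitary {R : Submodule ℂ (H →L[ℂ] H)}
    (h : ∀ U ∈ unitary (H →L[ℂ] H), U ∈ centralizer (centralizer (range π)) → U ∈ R) :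
    centralizer (centralizer (range π)) ⊆ R := fun T hT => by
  let B := StarSubalgebra.centralizer ℂ (centralizer (range π))
  have hB : (B : Set (H →L[ℂ] H)) = centralizer (centralizer (range π)) := by
    rw [StarSubalgebra.coe_centralizer, union_eq_self_of_subset_right]
    exact fun T hT => by simpa using star_mem_centralizer_range hT
  have : IsClosed (B : Set (H →L[ℂ] H)) := hB ▸ isClosed_centralizer _
  have hle : Submodule.span ℂ (unitary B : Set B) ≤ R.comap B.subtype.toAlgHom.toLinearMap :=
    Submodule.span_le.2 fun U hU => h U ⟨congr($(hU.1).1), congr($(hU.2).1)⟩ (hB ▸ U.2)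
  rw [CStarAlgebra.span_unitary] at hle
  exact hle (x := ⟨T, by rwa [← SetLike.mem_coe, hB]⟩) trivial

theorem IsQuasiContained.centralizer_centralizer_range (hπ : IsQuasiContained π σ)
    (hσ : IsVonNeumannRealization σ) : centralizer (centralizer (range π)) = range π := by
  refine Subset.antisymm ?_ subset_centralizer_centralizer
  refine centralizer_centralizer_range_subset_of_unitary
    (R := LinearMap.range π.toAlgHom.toLinearMap) fun U hU hUcc => ?_
  obtain ⟨x, hx, -⟩ := hσ.exists_comp_eq hU hUcc
  exact ⟨x, hπ.ext fun t ht => (ht x).trans (hx t ht)⟩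

end Intertwiners

/-! ### Normal vector states -/

section NormalVectorStates

/-- The multiple of a representation `σ` on the square-summable families `ι → L`. -/
noncomputable def amplification {M : Type*} [Ring M] [StarRing M] [Algebra ℂ M] {L : Type*}
    [NormedAddCommGroup L] [InnerProductSpace ℂ L] [CompleteSpace L] (ι : Type*)
    (σ : M →⋆ₐ[ℂ] (L →L[ℂ] L)) :
    M →⋆ₐ[ℂ] (lp (fun _ : ι => L) 2 →L[ℂ] lp (fun _ : ι => L) 2) where
  toFun X :=
    haveI : IsBoundedSMul (L →L[ℂ] L) L := .of_norm_smul_le fun T v => T.le_opNorm v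
    LinearMap.mkContinuous
      { toFun := fun k => σ X • k
        map_add' := smul_add (σ X)
        map_smul' := fun c k => smul_comm (σ X) c k } ‖σ X‖ (norm_smul_le (σ X))
  map_one' := by ext k i; exact congr($(map_one σ) (k i))
  map_zero' := by ext k i; exact congr($(map_zero σ) (k i))
  map_mul' X Y := by ext k i; exact congr($(map_mul σ X Y) (k i))
  map_add' X Y := by ext k i; exact congr($(map_add σ X Y) (k i))
  commutes' c := by ext k i; exact congr($(AlgHomClass.commutes σ c) (k i))
  map_star' X := by
    rw [ContinuousLinearMap.star_eq_adjoint, ContinuousLinearMap.eq_adjoint_iff]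
    intro k l
    rw [lp.inner_eq_tsum, lp.inner_eq_tsum]
    refine tsum_congr fun i => ?_
    change ⟪σ (star X) (k i), l i⟫_ℂ = ⟪k i, σ X (l i)⟫_ℂ
    rw [← adjoint_map, ContinuousLinearMap.adjoint_inner_left]

variable {M : Type u} [Ring M] [StarRing M] [Algebra ℂ M]
  {L : Type*} [NormedAddCommGroup L] [InnerProductSpace ℂ L] [CompleteSpace L]
  {H : Type*} [NormedAddCommGroup H] [InnerProductSpace ℂ H] [CompleteSpace H]
  {σ : M →⋆ₐ[ℂ] (L →L[ℂ] L)} {π : M →⋆ₐ[ℂ] (H →L[ℂ] H)} {ι : Type*}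

theorem amplification_apply (X : M) (k : lp (fun _ : ι => L) 2) (i : ι) :
    amplification ι σ X k i = σ X (k i) := rfl

theorem intertwines_single [DecidableEq ι] (i : ι) :
    Intertwines σ (amplification ι σ) (lp.singleContinuousLinearMap ℂ (fun _ : ι => L) 2 i) := by
  intro X
  ext v j
  simp only [ContinuousLinearMap.comp_apply, lp.singleContinuousLinearMap_apply, lp.coeFn_single,
    amplification_apply]
  exact (Pi.apply_single (fun _ => σ X) (fun _ => map_zero _) i v j).symm

theorem exists_intertwines_of_norm_le {Ω : H} {ξ : L} {C : ℝ}
    (h : ∀ X, ‖π X Ω‖ ≤ C * ‖σ X ξ‖) : ∃ S, Intertwines σ π S ∧ S ξ = Ω := by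
  let f : M →ₗ[ℂ] H := (ContinuousLinearMap.apply ℂ H Ω).toLinearMap ∘ₗ π.toAlgHom.toLinearMap
  let e : M →ₗ[ℂ] L := (ContinuousLinearMap.apply ℂ L ξ).toLinearMap ∘ₗ σ.toAlgHom.toLinearMap
  obtain ⟨S, hS, hS₀⟩ := exists_clm_of_norm_le (f := f) (e := e) h
  change ∀ X, S (σ X ξ) = π X Ω at hS
  refine ⟨S, fun X => eq_of_eqOn_of_eqOn_orthogonal (D := LinearMap.range e) ?_ fun k hk => ?_,
    by simpa using hS 1⟩
  · rintro _ ⟨Y, rfl⟩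
    change S (σ X (σ Y ξ)) = π X (S (σ Y ξ))
    rw [hS, ← mul_apply_eq_comp, ← map_mul, hS, map_mul, mul_apply_eq_comp]
  · rw [Submodule.span_eq] at hk
    rw [ContinuousLinearMap.comp_apply, ContinuousLinearMap.comp_apply, hS₀ k hk, map_zero]
    refine hS₀ _ ?_
    rintro _ ⟨Y, rfl⟩
    rw [← ContinuousLinearMap.adjoint_inner_left, adjoint_map]
    refine hk _ ⟨star X * Y, ?_⟩
    change σ (star X * Y) ξ = σ (star X) (σ Y ξ)
    rw [map_mul, mul_apply_eq_comp]

/-- By polarization, `4 re ⟪σ X x, σ X y⟫ ≤ ‖σ X (x + y)‖ ^ 2`. -/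
theorem norm_apply_le_of_inner_eq {Ω : H} {x y : L}
    (h : ∀ X, ⟪Ω, π X Ω⟫_ℂ = ⟪x, σ X y⟫_ℂ) (X : M) : ‖π X Ω‖ ≤ ‖σ X (x + y)‖ := by
  have hinner : ⟪π X Ω, π X Ω⟫_ℂ = ⟪σ X x, σ X y⟫_ℂ := by
    simp only [← ContinuousLinearMap.adjoint_inner_right, adjoint_map, ← mul_apply_eq_comp,
      ← map_mul, h]
  have hnorm : ‖π X Ω‖ ^ 2 = RCLike.re ⟪σ X x, σ X y⟫_ℂ := by
    rw [← hinner, inner_self_eq_norm_sq]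
  have hadd := norm_add_sq (𝕜 := ℂ) (σ X x) (σ X y)
  have hsub := norm_sub_sq (𝕜 := ℂ) (σ X x) (σ X y)
  rw [map_add]
  refine le_of_sq_le_sq ?_ (norm_nonneg _)
  nlinarith [hadd, hsub, sq_nonneg ‖σ X x - σ X y‖, sq_nonneg ‖π X Ω‖]

theorem isQuasiContained_of_intertwines_amplification
    {S : lp (fun _ : ι => L) 2 →L[ℂ] H} (hS : Intertwines (amplification ι σ) π S)
    {ξ : lp (fun _ : ι => L) 2} (hcyc : Dense (range fun X => π X (S ξ))) :
    IsQuasiContained π σ := by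
  classical
  intro h hh
  have hzero : innerSL ℂ h ∘L S = 0 := by
    refine lp.ext_continuousLinearMap (by norm_num) fun i => ContinuousLinearMap.ext fun v => ?_
    have := hh _ (hS.comp (intertwines_single i)).adjoint
    have h' := congr(⟪$this, v⟫_ℂ)
    rw [ContinuousLinearMap.adjoint_inner_left, inner_zero_left] at h'
    exact h'
  have horth : innerSL ℂ h = 0 := by
    refine ContinuousLinearMap.ext_on (hcyc.mono Submodule.subset_span) ?_
    rintro _ ⟨X, rfl⟩
    change innerSL ℂ h (π X (S ξ)) = 0
    rw [← hS.apply]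
    exact congr($hzero _)
  simpa using congr($horth h)

theorem isQuasiContained_of_hasSum {x y : ι → L}
    (hx : Summable fun n => ‖x n‖ ^ 2) (hy : Summable fun n => ‖y n‖ ^ 2) {Ω : H}
    (hω : ∀ X : M, HasSum (fun n => ⟪x n, σ X (y n)⟫_ℂ) ⟪Ω, π X Ω⟫_ℂ)
    (hcyc : Dense (range fun X => π X Ω)) : IsQuasiContained π σ := by
  have hmem {x : ι → L} (hx : Summable fun n => ‖x n‖ ^ 2) : Memℓp x 2 :=
    memℓp_gen (by simpa using hx)
  let x' : lp (fun _ : ι => L) 2 := ⟨x, hmem hx⟩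
  let y' : lp (fun _ : ι => L) 2 := ⟨y, hmem hy⟩
  have hinner (X : M) : ⟪Ω, π X Ω⟫_ℂ = ⟪x', amplification ι σ X y'⟫_ℂ :=
    (hω X).unique (lp.hasSum_inner x' (amplification ι σ X y'))
  have hle (X : M) : ‖π X Ω‖ ≤ 1 * ‖amplification ι σ X (x' + y')‖ :=
    (norm_apply_le_of_inner_eq hinner X).trans_eq (one_mul _).symm
  obtain ⟨S, hS, rfl⟩ := exists_intertwines_of_norm_le hle
  exact isQuasiContained_of_intertwines_amplification hS hcyc

theorem IsNormalFunctional.exists_isQuasiContained {φ : M →ₗ[ℂ] ℂ} (hφ : IsNormalFunctional φ)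
    {Ω : H} (hω : ∀ X, φ X = ⟪Ω, π X Ω⟫_ℂ) (hcyc : Dense (range fun X => π X Ω)) :
    ∃ (L : Type u) (_ : NormedAddCommGroup L) (_ : InnerProductSpace ℂ L) (_ : CompleteSpace L)
      (σ : M →⋆ₐ[ℂ] (L →L[ℂ] L)), IsVonNeumannRealization σ ∧ IsQuasiContained π σ := by
  obtain ⟨L, _, _, _, σ, hσ, x, y, hx, hy, hsum⟩ := hφ
  exact ⟨L, _, _, _, σ, hσ, isQuasiContained_of_hasSum hx hy (fun X => hω X ▸ hsum X) hcyc⟩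

theorem IsNormalFunctional.exists_support {φ : M →ₗ[ℂ] ℂ} (hφ : IsNormalFunctional φ)
    {Ω : H} (hω : ∀ X, φ X = ⟪Ω, π X Ω⟫_ℂ) (hcyc : Dense (range fun X => π X Ω)) :
    ∃ e : M, IsStarProjection e ∧ ∀ X, X * e = 0 ↔ π X = 0 := by
  obtain ⟨L, _, _, _, σ, hσ, hπ⟩ := hφ.exists_isQuasiContained hω hcyc
  exact hπ.exists_isStarProjection hσ

theorem IsNormalFunctional.centralizer_centralizer_range {φ : M →ₗ[ℂ] ℂ}
    (hφ : IsNormalFunctional φ) {Ω : H} (hω : ∀ X, φ X = ⟪Ω, π X Ω⟫_ℂ)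
    (hcyc : Dense (range fun X => π X Ω)) : centralizer (centralizer (range π)) = range π := by
  obtain ⟨L, _, _, _, σ, hσ, hπ⟩ := hφ.exists_isQuasiContained hω hcyc
  exact hπ.centralizer_centralizer_range hσ

end NormalVectorStates

/-! ### Haag duality -/

namespace LocalNet

section Algebras

variable {A : Type*} [CStarAlgebra A] {𝔄 : LocalNet A}
  {H : Type*} [NormedAddCommGroup H] [InnerProductSpace ℂ H] [CompleteSpace H]
  {π : A →⋆ₐ[ℂ] (H →L[ℂ] H)}

theorem alg_le_complAlg {O O₁ : Set M4} (h₁ : O₁ ∈ 𝔄.regions) (h : CausallySeparated O₁ O) :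
    𝔄.alg O₁ ≤ 𝔄.complAlg O := fun _ hX =>
  StarSubalgebra.le_topologicalClosure _ <|
    StarAlgebra.subset_adjoin ℂ _ (mem_iUnion₂.2 ⟨O₁, ⟨h₁, h⟩, hX⟩)

theorem complAlg_anti {O Q : Set M4} (h : O ⊆ Q) : 𝔄.complAlg Q ≤ 𝔄.complAlg O :=
  StarSubalgebra.topologicalClosure_mono (StarAlgebra.adjoin_mono (biUnion_subset_biUnion_left
    fun _ hO => ⟨hO.1, fun _ hx y hy => hO.2 hx y (h hy)⟩))

theorem commute_of_mem_complAlg {O : Set M4} (hO : O ∈ 𝔄.regions) {X B : A} (hX : X ∈ 𝔄.alg O)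
    (hB : B ∈ 𝔄.complAlg O) : Commute X B := by
  have hle : 𝔄.complAlg O ≤ StarSubalgebra.centralizer ℂ (𝔄.alg O : Set A) := by
    refine StarSubalgebra.topologicalClosure_minimal (StarAlgebra.adjoin_le ?_) ?_
    · refine iUnion₂_subset fun O₁ hO₁ Y hY => (StarSubalgebra.mem_centralizer_iff ℂ).2 ?_
      exact fun Z hZ => ⟨(𝔄.locality O₁ hO₁.1 O hO hO₁.2 Y hY Z hZ).symm,
        (𝔄.locality O₁ hO₁.1 O hO hO₁.2 Y hY _ (star_mem hZ)).symm⟩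
    · rw [StarSubalgebra.coe_centralizer]
      exact isClosed_centralizer _
  exact ((StarSubalgebra.mem_centralizer_iff ℂ).1 (hle hB) X hX).1

theorem range_comp_subtype (π : A →⋆ₐ[ℂ] (H →L[ℂ] H)) (S : StarSubalgebra ℂ A) :
    range (π.comp S.subtype) = π '' (S : Set A) := by
  ext Y
  simp

/-- The restriction of a representation to `A(O')`. -/
noncomputable abbrev complRep (𝔄 : LocalNet A) (π : A →⋆ₐ[ℂ] (H →L[ℂ] H)) (O : Set M4) :
    𝔄.complAlg O →⋆ₐ[ℂ] (H →L[ℂ] H) :=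
  π.comp (𝔄.complAlg O).subtype

theorem intertwines_complRep_mono
    {K : Type*} [NormedAddCommGroup K] [InnerProductSpace ℂ K] [CompleteSpace K]
    {σ : A →⋆ₐ[ℂ] (K →L[ℂ] K)} {O Q : Set M4} (h : O ⊆ Q) {t : H →L[ℂ] K}
    (ht : Intertwines (𝔄.complRep π O) (𝔄.complRep σ O) t) :
    Intertwines (𝔄.complRep π Q) (𝔄.complRep σ Q) t :=
  fun B => ht ⟨B, complAlg_anti h B.2⟩

theorem mem_dual_iff {O : Set M4} {Y : H →L[ℂ] H} :
    Y ∈ 𝔄.dual π O ↔ Intertwines (𝔄.complRep π O) (𝔄.complRep π O) Y := by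
  rw [← mem_centralizer_range_iff, range_comp_subtype, dual]

theorem induction_on_doubleCones {p : A → Prop} (hp : IsClosed {X | p X}) {O : Set M4}
    (hO : Bornology.IsBounded O)
    (h : ∀ R, IsDoubleCone R → O ⊆ R → ∀ X ∈ 𝔄.alg R, p X) (X : A) : p X := by
  refine hp.closure_subset_iff.2 (iUnion₂_subset fun Q hQ Y hY => ?_) (𝔄.dense X)
  obtain ⟨R, hR, hsub⟩ := exists_isDoubleCone_superset (hO.union (𝔄.bounded_of_mem Q hQ))
  rw [union_subset_iff] at hsub
  exact h R hR hsub.1 Y (𝔄.isotony Q hQ R (𝔄.doubleCone_mem R hR) hsub.2 hY)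

theorem injective_of_injOn_alg
    (h : ∀ R, IsDoubleCone R → InjOn π (𝔄.alg R)) : Function.Injective π := by
  refine (AddMonoidHomClass.isometry_of_norm π fun X => ?_).injective
  refine induction_on_doubleCones (𝔄 := 𝔄) (p := fun X => ‖π X‖ = ‖X‖)
    (isClosed_eq (map_continuous π).norm continuous_norm) Bornology.isBounded_empty
    (fun R hR _ Y hY => ?_) X
  have : IsClosed (𝔄.alg R : Set A) := 𝔄.isClosed_alg R (𝔄.doubleCone_mem R hR)
  exact NonUnitalStarAlgHom.norm_map (π.comp (𝔄.alg R).subtype) (injOn_iff_injective.1 (h R hR))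
    ⟨Y, hY⟩

end Algebras

section Vacuum

variable {A : Type u} [CStarAlgebra A] {𝔄 : LocalNet A}
  {H : Type v} [NormedAddCommGroup H] [InnerProductSpace ℂ H] [CompleteSpace H]
  {ω : A →ₗ[ℂ] ℂ} {π : A →⋆ₐ[ℂ] (H →L[ℂ] H)} {Ω : H}

/-- Haag duality in the form `π(A(O'))' = π(A(O))` for all double cones, which includes that the
local algebras of double cones are represented as von Neumann algebras. -/
def StrictHaagDuality (𝔄 : LocalNet A) (π : A →⋆ₐ[ℂ] (H →L[ℂ] H)) : Prop :=
  ∀ O, IsDoubleCone O → 𝔄.dual π O = π '' (𝔄.alg O : Set A)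

theorem StrictHaagDuality.commute_of_mem_dual (hHaag : 𝔄.StrictHaagDuality π) {Q Q' : Set M4}
    (hQ : IsDoubleCone Q) (hsep : CausallySeparated Q Q')
    {W W' : H →L[ℂ] H} (hW : W ∈ 𝔄.dual π Q) (hW' : W' ∈ 𝔄.dual π Q') : Commute W W' := by
  rw [hHaag Q hQ] at hW
  obtain ⟨X, hX, rfl⟩ := hW
  exact hW' _ ⟨X, alg_le_complAlg (𝔄.doubleCone_mem Q hQ) hsep hX, rfl⟩

theorem IsVacuum.dense_range_comp_subtype (hvac : 𝔄.IsVacuum ω π Ω) {O : Set M4}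
    (hO : O ∈ 𝔄.regions) : Dense (range fun X => π.comp (𝔄.alg O).subtype X Ω) := by
  have h := hvac.cyclic O hO
  rwa [image_eq_range] at h

theorem IsVacuum.centralizer_centralizer_image (hvac : 𝔄.IsVacuum ω π Ω) {O : Set M4}
    (hO : O ∈ 𝔄.regions) :
    centralizer (centralizer (π '' (𝔄.alg O : Set A))) = π '' (𝔄.alg O : Set A) := by
  rw [← range_comp_subtype]
  exact (hvac.locallyNormal O hO).centralizer_centralizer_range (fun X => hvac.gns X)
    (hvac.dense_range_comp_subtype hO)

theorem IsVacuum.strictHaagDuality (hvac : 𝔄.IsVacuum ω π Ω) (hHaag : 𝔄.HaagDuality π) :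
    𝔄.StrictHaagDuality π := fun O hO =>
  (hHaag O hO).trans (hvac.centralizer_centralizer_image (𝔄.doubleCone_mem O hO))

theorem IsVacuum.map_one_ne_zero (hvac : 𝔄.IsVacuum ω π Ω) : π 1 ≠ 0 := fun h => by
  have hω := hvac.gns 1
  rw [hvac.isState.2, h, zero_apply, inner_zero_right] at hω
  exact one_ne_zero hω

theorem PropertyB.eq_zero_of_map_eq_zero (hB : 𝔄.PropertyB) (hπ : π 1 ≠ 0) {O : Set M4}
    (hO : O ∈ 𝔄.regions) {E : A} (hE : E ∈ 𝔄.alg O) (hproj : IsStarProjection E)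
    (hE₀ : π E = 0) : E = 0 := by
  by_contra hne
  obtain ⟨Q, hQ, hOQ⟩ := exists_isDoubleCone_closure_ssubset (𝔄.bounded_of_mem O hO)
  obtain ⟨W, -, hW, hWE⟩ := hB (O, Q) ⟨hO, 𝔄.doubleCone_mem Q hQ, hOQ⟩ E hE hproj hne
  refine hπ ?_
  calc π 1 = π (star W * (W * star W) * W) := by rw [← mul_assoc, hW, one_mul, hW]
    _ = 0 := by rw [hWE, map_mul, map_mul, hE₀, mul_zero, zero_mul]

theorem IsVacuum.injOn_alg (hvac : 𝔄.IsVacuum ω π Ω) (hB : 𝔄.PropertyB) {O : Set M4}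
    (hO : O ∈ 𝔄.regions) : InjOn π (𝔄.alg O) := by
  obtain ⟨e, he, hker⟩ := (hvac.locallyNormal O hO).exists_support
    (π := π.comp (𝔄.alg O).subtype) (fun X => hvac.gns X) (hvac.dense_range_comp_subtype hO)
  have hcompl : (1 : 𝔄.alg O) - e = 0 := by
    refine Subtype.ext (hB.eq_zero_of_map_eq_zero hvac.map_one_ne_zero hO (1 - e).2
      (he.one_sub.map (𝔄.alg O).subtype) ((hker (1 - e)).1 ?_))
    rw [sub_mul, one_mul, he.isIdempotentElem.eq, sub_self]
  rw [sub_eq_zero] at hcompl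
  refine injOn_iff_injective.2 ((injective_iff_map_eq_zero (π.comp (𝔄.alg O).subtype)).2 ?_)
  intro X hX
  rwa [← hker, ← hcompl, mul_one] at hX

theorem IsVacuum.injective (hvac : 𝔄.IsVacuum ω π Ω) (hB : 𝔄.PropertyB) : Function.Injective π :=
  injective_of_injOn_alg fun R hR => hvac.injOn_alg hB (𝔄.doubleCone_mem R hR)

end Vacuum

end LocalNet

/-! ### Local states and localized endomorphisms -/

section Compressions

variable {M : Type*} [Ring M] [StarRing M] [Algebra ℂ M]
  {H : Type*} [NormedAddCommGroup H] [InnerProductSpace ℂ H] [CompleteSpace H]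
  {K : Type*} [NormedAddCommGroup K] [InnerProductSpace ℂ K] [CompleteSpace K]
  {L : Type*} [NormedAddCommGroup L] [InnerProductSpace ℂ L] [CompleteSpace L]

theorem intertwines_of_compression {π : M →⋆ₐ[ℂ] (H →L[ℂ] H)} {σ : M →⋆ₐ[ℂ] (K →L[ℂ] K)}
    {V : H →L[ℂ] K} (h : ∀ X, V.adjoint ∘L σ X ∘L V = π X) : Intertwines π σ V := by
  have hV (X : M) (v : H) : V.adjoint (σ X (V v)) = π X v := congr($(h X) v)
  have hiso (v : H) : V.adjoint (V v) = v := by simpa only [map_one, one_apply_eq_self] using hV 1 v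
  intro X
  ext v
  -- `V† σ(X⋆X) V = π(X⋆X)` is the multiplicative-domain condition `‖V π(X) v - σ(X) V v‖ = 0`.
  have hσσ : ⟪σ X (V v), σ X (V v)⟫_ℂ = ⟪π X v, π X v⟫_ℂ := by
    rw [← ContinuousLinearMap.adjoint_inner_right (σ X),
      ← ContinuousLinearMap.adjoint_inner_right (π X), adjoint_map, adjoint_map,
      ← mul_apply_eq_comp, ← mul_apply_eq_comp, ← map_mul, ← map_mul, ← hV,
      ContinuousLinearMap.adjoint_inner_right]
  have hσV : ⟪σ X (V v), V (π X v)⟫_ℂ = ⟪π X v, π X v⟫_ℂ := by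
    rw [← ContinuousLinearMap.adjoint_inner_left, hV]
  have hVσ : ⟪V (π X v), σ X (V v)⟫_ℂ = ⟪π X v, π X v⟫_ℂ := by
    rw [← ContinuousLinearMap.adjoint_inner_right, hV]
  have hVV : ⟪V (π X v), V (π X v)⟫_ℂ = ⟪π X v, π X v⟫_ℂ := by
    rw [← ContinuousLinearMap.adjoint_inner_right, hiso]
  rw [ContinuousLinearMap.comp_apply, ContinuousLinearMap.comp_apply, ← sub_eq_zero,
    ← inner_self_eq_zero (𝕜 := ℂ), inner_sub_left, inner_sub_right, inner_sub_right, hσσ, hσV,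
    hVσ, hVV, sub_self]

theorem isStarProjection_comp_adjoint {V : H →L[ℂ] K} (hV : V.adjoint ∘L V = 1) :
    IsStarProjection (V ∘L V.adjoint) where
  isIdempotentElem := by
    change (V ∘L V.adjoint) ∘L (V ∘L V.adjoint) = V ∘L V.adjoint
    rw [← ContinuousLinearMap.comp_assoc, ContinuousLinearMap.comp_assoc V, hV]
    rfl
  isSelfAdjoint := by
    rw [ContinuousLinearMap.isSelfAdjoint_iff', ContinuousLinearMap.adjoint_comp,
      ContinuousLinearMap.adjoint_adjoint]

theorem exists_linearIsometryEquiv_eq_adjoint_comp {V : H →L[ℂ] L} {W : K →L[ℂ] L}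
    (hV : V.adjoint ∘L V = 1) (hW : W.adjoint ∘L W = 1)
    (h : W ∘L W.adjoint = V ∘L V.adjoint) :
    ∃ U : H ≃ₗᵢ[ℂ] K, (U : H →L[ℂ] K) = W.adjoint ∘L V := by
  have hV' (v : H) : V.adjoint (V v) = v := congr($hV v)
  have hW' (k : K) : W.adjoint (W k) = k := congr($hW k)
  have h' (l : L) : W (W.adjoint l) = V (V.adjoint l) := congr($h l)
  have hinner (v w : H) : ⟪(W.adjoint ∘L V) v, (W.adjoint ∘L V) w⟫_ℂ = ⟪v, w⟫_ℂ := by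
    simp only [ContinuousLinearMap.comp_apply]
    rw [ContinuousLinearMap.adjoint_inner_left, h', hV',
      ← ContinuousLinearMap.adjoint_inner_left, hV']
  refine ⟨.ofSurjective ((W.adjoint ∘L V : H →ₗ[ℂ] K).isometryOfInner hinner) fun k =>
    ⟨V.adjoint (W k), ?_⟩, rfl⟩
  change W.adjoint (V (V.adjoint (W k))) = k
  rw [← h', hW', hW']

end Compressions

section Stinespring

variable {A : Type*} [CStarAlgebra A]
  {H : Type*} [NormedAddCommGroup H] [InnerProductSpace ℂ H] [CompleteSpace H]
  {K : Type*} [NormedAddCommGroup K] [InnerProductSpace ℂ K] [CompleteSpace K]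
  {L : Type*} [NormedAddCommGroup L] [InnerProductSpace ℂ L] [CompleteSpace L]

theorem IsMinimalStinespring.conj {Φ : A → (H →L[ℂ] H)} {π : A →⋆ₐ[ℂ] (K →L[ℂ] K)}
    {V : H →L[ℂ] K} (h : IsMinimalStinespring Φ π V) (U : K ≃ₗᵢ[ℂ] L) :
    IsMinimalStinespring Φ (U.conjStarAlgEquiv.toStarAlgHom.comp π) ((U : K →L[ℂ] L) ∘L V) := by
  have hU (k : K) : (U : K →L[ℂ] L).adjoint (U k) = k := by
    rw [LinearIsometryEquiv.adjoint_eq_symm]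
    exact U.symm_apply_apply k
  have hmap (X : A) (v : H) : U.conjStarAlgEquiv (π X) (U (V v)) = U (π X (V v)) := by
    rw [LinearIsometryEquiv.conjStarAlgEquiv_apply_apply, U.symm_apply_apply]
  refine ⟨fun X => ?_, ?_⟩
  · ext v
    rw [h.1 X, ContinuousLinearMap.adjoint_comp]
    change V.adjoint (π X (V v)) =
      V.adjoint ((U : K →L[ℂ] L).adjoint (U.conjStarAlgEquiv (π X) (U (V v))))
    rw [hmap, hU]
  · have himage : {l | ∃ X v, l = (U.conjStarAlgEquiv.toStarAlgHom.comp π) X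
        (((U : K →L[ℂ] L) ∘L V) v)} = (U : K →L[ℂ] L) '' {k | ∃ X v, k = π X (V v)} := by
      ext l
      constructor
      · rintro ⟨X, v, rfl⟩
        exact ⟨_, ⟨X, v, rfl⟩, (hmap X v).symm⟩
      · rintro ⟨_, ⟨X, v, rfl⟩, rfl⟩
        exact ⟨X, v, (hmap X v).symm⟩
    rw [himage]
    exact (congrArg Submodule.topologicalClosure (Submodule.map_span (U : K →ₗ[ℂ] L) _)).symm.trans
      (DenseRange.topologicalClosure_map_submodule (f := (U : K →L[ℂ] L)) U.surjective.denseRange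
        h.2)

end Stinespring

namespace LocalNet

section Endomorphisms

variable {A : Type u} [CStarAlgebra A] {𝔄 : LocalNet A}
  {H : Type v} [NormedAddCommGroup H] [InnerProductSpace ℂ H] [CompleteSpace H]
  {π : A →⋆ₐ[ℂ] (H →L[ℂ] H)}

theorem exists_endoRep_eq (hπ : Function.Injective π) {τ : A →⋆ₐ[ℂ] (H →L[ℂ] H)}
    (hτ : ∀ X, τ X ∈ π.range) : ∃ ρ : π.range →⋆ₐ[ℂ] π.range, endoRep π ρ = τ := by
  let ε := StarAlgEquiv.ofInjective π hπ
  refine ⟨(τ.codRestrict π.range hτ).comp ε.symm.toStarAlgHom, ?_⟩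
  ext1 X
  exact congrArg τ (ε.symm_apply_apply X)

theorem isLocalized_iff {O : Set M4} {ρ : π.range →⋆ₐ[ℂ] π.range} :
    𝔄.IsLocalized π O ρ ↔ 𝔄.complRep (endoRep π ρ) O = 𝔄.complRep π O := by
  simp only [IsLocalized, Subtype.ext_iff, StarAlgHom.ext_iff, Subtype.forall]
  rfl

theorem StrictHaagDuality.mem_range_of_complRep_eq (hHaag : 𝔄.StrictHaagDuality π)
    (hπ : Function.Injective π) {O : Set M4} (hO : Bornology.IsBounded O)
    {τ : A →⋆ₐ[ℂ] (H →L[ℂ] H)} (hτ : 𝔄.complRep τ O = 𝔄.complRep π O) (X : A) :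
    τ X ∈ π.range := by
  have hclosed : IsClosed (range π) :=
    (NonUnitalStarAlgHom.isometry π hπ).isClosedEmbedding.isClosed_range
  refine induction_on_doubleCones (𝔄 := 𝔄) (p := fun X => τ X ∈ range π)
    (hclosed.preimage (map_continuous τ)) hO (fun R hR hOR Y hY => ?_) X
  have hdual : τ Y ∈ 𝔄.dual π R := by
    rintro _ ⟨B, hB, rfl⟩
    have hτB : τ B = π B := congr($hτ ⟨B, complAlg_anti hOR hB⟩)
    rw [← hτB, ← map_mul, ← map_mul, commute_of_mem_complAlg (𝔄.doubleCone_mem R hR) hY hB]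
  rw [hHaag R hR] at hdual
  exact image_subset_range _ _ hdual

end Endomorphisms

section LocalStates

variable {A : Type u} [CStarAlgebra A] {𝔄 : LocalNet A}
  {H : Type v} [NormedAddCommGroup H] [InnerProductSpace ℂ H] [CompleteSpace H]
  {K : Type w} [NormedAddCommGroup K] [InnerProductSpace ℂ K] [CompleteSpace K]
  {π : A →⋆ₐ[ℂ] (H →L[ℂ] H)} {π₁ : A →⋆ₐ[ℂ] (K →L[ℂ] K)} {V : H →L[ℂ] K}
  [PartialOrder A] [StarOrderedRing A] {Λ : Set M4 × Set M4} {T : A →CP A} {O : Set M4}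

theorem IsLocalState.apply_of_mem (hT : 𝔄.IsLocalState Λ T) {B : A} (hB : B ∈ 𝔄.complAlg Λ.2) :
    T B = B := by
  simpa only [one_mul, hT.1] using hT.2.1 1 B hB

theorem IsLocalState.apply_mul_left (hT : 𝔄.IsLocalState Λ T) {B : A} (hB : B ∈ 𝔄.complAlg Λ.2)
    (X : A) : T (B * X) = B * T X := by
  have h := congrArg star (hT.2.1 (star X) (star B) (star_mem hB))
  rwa [star_mul, ← map_star, ← map_star, star_mul, star_star, star_star] at h

theorem IsLocalState.map_mem_alg (hT : 𝔄.IsLocalState Λ T) (hHaag : 𝔄.StrictHaagDuality π)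
    (hπ : Function.Injective π) {R : Set M4} (hR : IsDoubleCone R) (hΛR : Λ.2 ⊆ R) {X : A}
    (hX : X ∈ 𝔄.alg R) : T X ∈ 𝔄.alg R := by
  have hdual : π (T X) ∈ 𝔄.dual π R := by
    rintro _ ⟨B, hB, rfl⟩
    have hBΛ := complAlg_anti hΛR hB
    rw [← map_mul, ← map_mul, ← hT.2.1 X B hBΛ, ← hT.apply_mul_left hBΛ X,
      commute_of_mem_complAlg (𝔄.doubleCone_mem R hR) hX hB]
  rw [hHaag R hR] at hdual
  obtain ⟨Y, hY, hYX⟩ := hdual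
  rwa [← hπ hYX]

theorem IsLocalState.intertwines_complRep (hT : 𝔄.IsLocalState Λ T)
    (hV : ∀ X, π (T X) = V.adjoint ∘L π₁ X ∘L V) (hO : Λ.2 ⊆ O) :
    Intertwines (𝔄.complRep π O) (𝔄.complRep π₁ O) V :=
  intertwines_of_compression fun B =>
    (hV B).symm.trans (congrArg π (hT.apply_of_mem (complAlg_anti hO B.2)))

theorem exists_corresponds_of_intertwines (hHaag : 𝔄.StrictHaagDuality π)
    (hπ : Function.Injective π) (hO : Bornology.IsBounded O)
    (hS : IsMinimalStinespring (fun X => π (T X)) π₁ V)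
    (hV : Intertwines (𝔄.complRep π O) (𝔄.complRep π₁ O) V) {U : H ≃ₗᵢ[ℂ] K}
    (hU : Intertwines (𝔄.complRep π O) (𝔄.complRep π₁ O) (U : H →L[ℂ] K)) :
    ∃ ρ : π.range →⋆ₐ[ℂ] π.range, 𝔄.Corresponds π O T ρ := by
  set τ := U.symm.conjStarAlgEquiv.toStarAlgHom.comp π₁
  have hτ : 𝔄.complRep τ O = 𝔄.complRep π O := by
    ext B v
    exact (congrArg U.symm (hU.apply B v).symm).trans (U.symm_apply_apply _)
  obtain ⟨ρ, hρ⟩ := exists_endoRep_eq hπ (hHaag.mem_range_of_complRep_eq hπ hO hτ)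
  refine ⟨ρ, isLocalized_iff.2 (by rw [hρ, hτ]), (U.symm : K →L[ℂ] H) ∘L V, ?_, ?_⟩
  · have hU' := hU.adjoint
    rw [LinearIsometryEquiv.adjoint_eq_symm] at hU'
    exact mem_dual_iff.2 (hU'.comp hV)
  · rw [hρ]
    exact hS.conj U.symm

theorem IsLocalState.exists_corresponds [Nontrivial H] (hT : 𝔄.IsLocalState Λ T)
    (hΛ : IsDoubleCone Λ.2) (hHaag : 𝔄.StrictHaagDuality π) (hπ : Function.Injective π)
    (hS : IsMinimalStinespring (fun X => π (T X)) π₁ V) (hDHR : 𝔄.PropertyDHR π₁)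
    (hO : IsDoubleCone O) (hΛO : closure Λ.2 ⊂ O) :
    ∃ ρ : π.range →⋆ₐ[ℂ] π.range, 𝔄.Corresponds π O T ρ := by
  have hO_mem := 𝔄.doubleCone_mem O hO
  have hisom : V.adjoint ∘L V = 1 := by
    have h : π (T 1) = V.adjoint ∘L π₁ 1 ∘L V := hS.1 1
    rw [hT.1, map_one, map_one] at h
    exact h.symm
  have hV := hT.intertwines_complRep (𝔄 := 𝔄) hS.1 Subset.rfl
  have hne : V ∘L V.adjoint ≠ 0 := fun h => by
    have hzero : (1 : H →L[ℂ] H) = V.adjoint ∘L (V ∘L V.adjoint) ∘L V := by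
      rw [ContinuousLinearMap.comp_assoc, hisom, ← ContinuousLinearMap.comp_assoc, hisom]
      rfl
    rw [h, ContinuousLinearMap.zero_comp, ContinuousLinearMap.comp_zero] at hzero
    exact one_ne_zero hzero
  obtain ⟨W, hW, hWW, hWV⟩ := hDHR (Λ.2, O)
    ⟨⟨𝔄.doubleCone_mem _ hΛ, hO_mem, hΛO⟩, hΛ, hO⟩ (V ∘L V.adjoint)
    (mem_dual_iff.2 (hV.comp hV.adjoint)) (isStarProjection_comp_adjoint hisom) hne
  obtain ⟨U, hU⟩ := exists_linearIsometryEquiv_eq_adjoint_comp hisom hWW hWV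
  have hVO := intertwines_complRep_mono (subset_closure.trans hΛO.subset) hV
  refine exists_corresponds_of_intertwines (U := U) hHaag hπ (𝔄.bounded_of_mem O hO_mem) hS hVO ?_
  rw [hU]
  exact (mem_dual_iff.1 hW).adjoint.comp hVO

/-- The operator `W` implements the map `T` on `A(O')`. -/
def Implements (𝔄 : LocalNet A) (π : A →⋆ₐ[ℂ] (H →L[ℂ] H)) (O : Set M4) (T : A →CP A)
    (W : H →L[ℂ] H) : Prop :=
  ∀ X ∈ 𝔄.complAlg O, π (T X) = star W * π X * W

theorem Corresponds.exists_implements {ρ : π.range →⋆ₐ[ℂ] π.range} (hρ : 𝔄.Corresponds π O T ρ)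
    (htr : 𝔄.IsTransportable π O ρ) (a : M4) : ∃ W, 𝔄.Implements π (translateRegion a O) T W := by
  obtain ⟨-, V, -, hV, -⟩ := hρ
  obtain ⟨ρ', hρ', U, -, -, hU⟩ := htr a
  refine ⟨star U * V, fun X hX => ?_⟩
  have hρX : endoRep π ρ X = U * π X * star U := by
    change (ρ (π.rangeRestrict X) : H →L[ℂ] H) = _
    rw [hU, hρ' X hX]
    rfl
  have hTX : π (T X) = star V * endoRep π ρ X * V := hV X
  rw [hTX, hρX, star_mul, star_star]
  simp only [mul_assoc]

theorem IsLocalState.exists_implements [Nontrivial H] (hT : 𝔄.IsLocalState Λ T)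
    (hΛ : IsDoubleCone Λ.2) (hHaag : 𝔄.StrictHaagDuality π) (hπ : Function.Injective π)
    (hS : IsMinimalStinespring (fun X => π (T X)) π₁ V) (hDHR : 𝔄.PropertyDHR π₁)
    (htr : 𝔄.HasTransportableEndomorphisms π Λ.2 T) :
    ∃ O, Bornology.IsBounded O ∧ ∀ a, ∃ W, 𝔄.Implements π (translateRegion a O) T W := by
  obtain ⟨O, hO, hΛO⟩ :=
    exists_isDoubleCone_closure_ssubset (𝔄.bounded_of_mem _ (𝔄.doubleCone_mem _ hΛ))
  obtain ⟨ρ, hρ⟩ := hT.exists_corresponds hΛ hHaag hπ hS hDHR hO hΛO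
  exact ⟨O, 𝔄.bounded_of_mem O (𝔄.doubleCone_mem O hO),
    hρ.exists_implements (htr O hO (subset_closure.trans hΛO.subset) ρ hρ)⟩

theorem IsLocalState.mem_dual_of_implements (hT : 𝔄.IsLocalState Λ T) {Q : Set M4}
    {W : H →L[ℂ] H} (hW : 𝔄.Implements π O T W) (hO : O ⊆ Q) (hΛ : Λ.2 ⊆ Q) : W ∈ 𝔄.dual π Q := by
  refine mem_dual_iff.2 (intertwines_of_compression fun B => ?_)
  have hB := hW B (complAlg_anti hO B.2)
  rw [hT.apply_of_mem (complAlg_anti hΛ B.2)] at hB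
  exact hB.symm

theorem Implements.apply_apply_comm {O₁ O₂ : Set M4} {T₁ T₂ : A →CP A} {W₁ W₂ : H →L[ℂ] H}
    (h₁ : 𝔄.Implements π O₁ T₁ W₁) (h₂ : 𝔄.Implements π O₂ T₂ W₂) (hW : Commute W₁ W₂) {X : A}
    (hX₁ : X ∈ 𝔄.complAlg O₁) (hX₂ : X ∈ 𝔄.complAlg O₂) (hT₁X : T₁ X ∈ 𝔄.complAlg O₂)
    (hT₂X : T₂ X ∈ 𝔄.complAlg O₁) : π (T₁ (T₂ X)) = π (T₂ (T₁ X)) := by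
  rw [h₁ _ hT₂X, h₂ X hX₂, h₂ _ hT₁X, h₁ X hX₁]
  calc star W₁ * (star W₂ * π X * W₂) * W₁
      = star (W₂ * W₁) * π X * (W₂ * W₁) := by simp only [star_mul, mul_assoc]
    _ = star (W₁ * W₂) * π X * (W₁ * W₂) := by rw [hW.eq]
    _ = star W₂ * (star W₁ * π X * W₁) * W₂ := by simp only [star_mul, mul_assoc]

end LocalStates

end LocalNet

theorem mainTheorem3_general {A : Type u} [CStarAlgebra A] [PartialOrder A] [StarOrderedRing A]
    (𝔄 : LocalNet A)
    {H₀ : Type v} [NormedAddCommGroup H₀] [InnerProductSpace ℂ H₀] [CompleteSpace H₀]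
    {π₀ : A →⋆ₐ[ℂ] (H₀ →L[ℂ] H₀)} (hπ₀ : Function.Injective π₀) (hHaag : 𝔄.StrictHaagDuality π₀)
    {Λ₁ Λ₂ : Set M4 × Set M4} (hΛ₁ : IsDoubleCone Λ₁.2) (hΛ₂ : IsDoubleCone Λ₂.2)
    (hsep : CausallySeparated Λ₁.2 Λ₂.2)
    {T₁ T₂ : A →CP A} (hT₁ : 𝔄.IsLocalState Λ₁ T₁) (hT₂ : 𝔄.IsLocalState Λ₂ T₂)
    {K₁ : Type w} [NormedAddCommGroup K₁] [InnerProductSpace ℂ K₁] [CompleteSpace K₁]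
    {π₁ : A →⋆ₐ[ℂ] (K₁ →L[ℂ] K₁)} {V₁ : H₀ →L[ℂ] K₁}
    (hS₁ : IsMinimalStinespring (fun X => π₀ (T₁ X)) π₁ V₁) (hDHR₁ : 𝔄.PropertyDHR π₁)
    {K₂ : Type z} [NormedAddCommGroup K₂] [InnerProductSpace ℂ K₂] [CompleteSpace K₂]
    {π₂ : A →⋆ₐ[ℂ] (K₂ →L[ℂ] K₂)} {V₂ : H₀ →L[ℂ] K₂}
    (hS₂ : IsMinimalStinespring (fun X => π₀ (T₂ X)) π₂ V₂) (hDHR₂ : 𝔄.PropertyDHR π₂)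
    (htr₁ : 𝔄.HasTransportableEndomorphisms π₀ Λ₁.2 T₁)
    (htr₂ : 𝔄.HasTransportableEndomorphisms π₀ Λ₂.2 T₂) (X : A) :
    π₀ (T₁ (T₂ X)) = π₀ (T₂ (T₁ X)) := by
  cases subsingleton_or_nontrivial H₀
  · exact Subsingleton.elim _ _
  have hD₁ := 𝔄.bounded_of_mem _ (𝔄.doubleCone_mem _ hΛ₁)
  have hD₂ := 𝔄.bounded_of_mem _ (𝔄.doubleCone_mem _ hΛ₂)
  obtain ⟨O₁, hO₁, hW₁⟩ := hT₁.exists_implements hΛ₁ hHaag hπ₀ hS₁ hDHR₁ htr₁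
  obtain ⟨O₂, hO₂, hW₂⟩ := hT₂.exists_implements hΛ₂ hHaag hπ₀ hS₂ hDHR₂ htr₂
  refine LocalNet.induction_on_doubleCones (𝔄 := 𝔄)
    (p := fun X => π₀ (T₁ (T₂ X)) = π₀ (T₂ (T₁ X)))
    (isClosed_eq (by fun_prop) (by fun_prop)) (hD₁.union hD₂) (fun R hR hΛR X hX => ?_) X
  obtain ⟨hΛ₁R, hΛ₂R⟩ := union_subset_iff.1 hΛR
  have hR_mem := 𝔄.doubleCone_mem R hR
  obtain ⟨a, Q₁, Q₂, hQ₁, -, hQ, hΛQ₁, hΛQ₂, hOQ₁, hOQ₂, hRO₁, hRO₂⟩ :=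
    hsep.exists_moving_apart hΛ₁ hΛ₂ hO₁ hO₂ (𝔄.bounded_of_mem R hR_mem)
  obtain ⟨W₁, hW₁⟩ := hW₁ a
  obtain ⟨W₂, hW₂⟩ := hW₂ (-a)
  have hle₁ := LocalNet.alg_le_complAlg (𝔄 := 𝔄) hR_mem hRO₁
  have hle₂ := LocalNet.alg_le_complAlg (𝔄 := 𝔄) hR_mem hRO₂
  exact hW₁.apply_apply_comm hW₂
    (hHaag.commute_of_mem_dual hQ₁ hQ (hT₁.mem_dual_of_implements hW₁ hOQ₁ hΛQ₁)
      (hT₂.mem_dual_of_implements hW₂ hOQ₂ hΛQ₂))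
    (hle₁ hX) (hle₂ hX) (hle₂ (hT₁.map_mem_alg hHaag hπ₀ hR hΛ₁R hX))
    (hle₁ (hT₂.map_mem_alg hHaag hπ₀ hR hΛ₂R hX))

theorem mainTheorem3 {A : Type u} [CStarAlgebra A] [PartialOrder A] [StarOrderedRing A]
    (𝔄 : LocalNet A) (hB : 𝔄.PropertyB)
    {H₀ : Type v} [NormedAddCommGroup H₀] [InnerProductSpace ℂ H₀] [CompleteSpace H₀]
    [TopologicalSpace.SeparableSpace H₀]
    (ω₀ : A →ₗ[ℂ] ℂ) (π₀ : A →⋆ₐ[ℂ] (H₀ →L[ℂ] H₀)) (Ω : H₀) (hvac : 𝔄.IsVacuum ω₀ π₀ Ω)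
    (hHaag : 𝔄.HaagDuality π₀)
    (Λ₁ Λ₂ : Set M4 × Set M4) (hΛ₁ : Λ₁ ∈ 𝔄.doubleConePairs) (hΛ₂ : Λ₂ ∈ 𝔄.doubleConePairs)
    (hsep : CausallySeparated Λ₁.2 Λ₂.2)
    (T₁ T₂ : A →CP A) (hT₁ : 𝔄.IsLocalState Λ₁ T₁) (hT₂ : 𝔄.IsLocalState Λ₂ T₂)
    {K₁ : Type w} [NormedAddCommGroup K₁] [InnerProductSpace ℂ K₁] [CompleteSpace K₁]
    (π₁ : A →⋆ₐ[ℂ] (K₁ →L[ℂ] K₁)) (V₁ : H₀ →L[ℂ] K₁)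
    (hS₁ : IsMinimalStinespring (fun X => π₀ (T₁ X)) π₁ V₁) (hDHR₁ : 𝔄.PropertyDHR π₁)
    {K₂ : Type z} [NormedAddCommGroup K₂] [InnerProductSpace ℂ K₂] [CompleteSpace K₂]
    (π₂ : A →⋆ₐ[ℂ] (K₂ →L[ℂ] K₂)) (V₂ : H₀ →L[ℂ] K₂)
    (hS₂ : IsMinimalStinespring (fun X => π₀ (T₂ X)) π₂ V₂) (hDHR₂ : 𝔄.PropertyDHR π₂)
    (htr₁ : 𝔄.HasTransportableEndomorphisms π₀ Λ₁.2 T₁)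
    (htr₂ : 𝔄.HasTransportableEndomorphisms π₀ Λ₂.2 T₂) :
    (fun X => π₀ ((T₁ ∘ T₂) X)) = fun X => π₀ ((T₂ ∘ T₁) X) := by
  funext X
  exact mainTheorem3_general 𝔄 (hvac.injective hB) (hvac.strictHaagDuality hHaag) hΛ₁.2.2 hΛ₂.2.2
    hsep hT₁ hT₂ hS₁ hDHR₁ hS₂ hDHR₂ htr₁ htr₂ X
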